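/- **Conventions.** Let $\mathbb N=\{0,1,2,\dots\}$. For subsets $A,B\subset X$ of $\mathbb N^n$, $(A,B)$ is an *$X$-pair* if $A+B=X$ and every $c\in X$ has exactly one decomposition $c=a+b$ with $a\in A$, $b\in B$. An *$\mathbb N^*$-pair* is an $\mathbb N^n$-pair for some $n\ge 1$. An $\mathbb N^n$-pair $(T,S)$ is *primitive* if it is not, up to a permutation of the coordinates, a Cartesian product $(I_1\times I_2,J_1\times J_2)$ of an $\mathbb N^k$-pair $(I_1,J_1)$ and an $\mathbb N^{n-k}$-pair $(I_2,J_2)$ with $1\le k<n$. An *interval pair of size $N\ge 1$* is a $\{0,1,\dots,N-1\}$-pair $(C,D)$ (for $N=1$ it is $(\{0\},\{0\})$). For $A\subset\mathbb N^n$ put $A(x)=\sum_{\mathbf a\in A}x^{\mathbf a}$, and for $\mathbf a\in(\mathbb N\setminus\{0\})^p$ put $L_{\mathbf a}=\mathbb N^p\setminus(\mathbb N^p+\mathbf a)$. **Weighted trees.** Let $(V,\Gamma)$ be a finite tree with root $\phi$. The offsprings of a node $u$ are its neighbours whose distance to $\phi$ is one more than that of $u$; a *top* is a node without offspring, and $V_0$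 is the set of tops. Assume that every node that is not a top has at least two offsprings. A *weight* is a quadruple $((T_0,S_0),\delta,\alpha,\Phi)$, where $(T_0,S_0)$ is an $\mathbb N$-pair (the initial pair), $\delta:V\setminus V_0\to\{0,1\}$, $\alpha:V\setminus\{\phi\}\to\mathbb N\setminus\{0\}$, $\Phi:V\setminus\{\phi\}\to\{\text{interval pairs}\}$, and, if $\phi$ is not a top, $\delta_\phi=1$ whenever $T_0=\{0\}$ and $\delta_\phi=0$ whenever $S_0=\{0\}$. **The generated pair.** It is defined recursively, the tops serving as variables. If $V=\{\phi\}$, it is $(T_0,S_0)$. Otherwise choose a node $z$ that is not a top and all of whose offsprings $x_1,\dots,x_p$ are tops; let $x_{p+1},\dots,x_n$ be the remaining tops and $\bar x=(x_{p+1},\dots,x_n)$. Delete $x_1,\dots,x_p$ from the tree, restrict the weight, and let $(\widetilde T,\widetilde S)$, in the variables $(z,\bar x)$, be the pair generated by the resulting tree. With $\delta=\delta_z$, $a_j=\alpha_{x_j}$, $\mathbf a=(a_1,\dots,a_p)$, $(C_j,D_j)=\Phi_{x_j}$ and $N_j$ the size of $(C_j,D_j)$, the generated pair $(T,S)$ is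 given by $$T(x)=\Big(\prod_{j=1}^pC_j(x_j)\Big)L_{\mathbf a}(x_1^{N_1},\dots,x_p^{N_p})^{\delta}\;\widetilde T\Big(\prod_{j=1}^px_j^{a_jN_j},\bar x\Big),$$ $$S(x)=\Big(\prod_{j=1}^pD_j(x_j)\Big)L_{\mathbf a}(x_1^{N_1},\dots,x_p^{N_p})^{1-\delta}\;\widetilde S\Big(\prod_{j=1}^px_j^{a_jN_j},\bar x\Big).$$ A pair of subsets of $\mathbb N^n$ is *generated by the weighted tree* if it arises in this way for some choice of the nodes $z$ and some numbering of the $n$ tops. **Theorem.** Let $n\ge 1$ and $T,S\subset\mathbb N^n$. Then $(T,S)$ is a primitive $\mathbb N^n$-pair if and only if it is generated by a weighted rooted tree with exactly $n$ tops. -/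

import Mathlib

open scoped Pointwise

namespace NPair

/-- `(A, B)` is a complementing pair of `X`: both sets lie in `X`, `A + B = X`, and the
decomposition `c = a + b` of each element of the sum is unique. -/
structure IsPairOf {M : Type*} [AddCommMonoid M] (X A B : Set M) : Prop where
  left_subset : A ⊆ X
  right_subset : B ⊆ X
  add_eq : A + B = X
  direct : Set.InjOn (fun p : M × M => p.1 + p.2) (A ×ˢ B)

/-- `(T, S)` is an `ℕ^ι`-pair. -/
def IsNPair {ι : Type*} (T S : Set (ι → ℕ)) : Prop :=
  IsPairOf Set.univ T S

/-- `(C, D)` is an interval pair of size `N`, that is, a `{0, …, N - 1}`-pair. The size `1`, for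
which `C = D = {0}`, is allowed. -/
structure IsIntervalPair (N : ℕ) (C D : Set ℕ) : Prop where
  one_le_size : 1 ≤ N
  pair : IsPairOf (Set.Iio N) C D

/-- The Cartesian product of `I₁ ⊆ ℕ^s` and `I₂ ⊆ ℕ^(sᶜ)`, as a subset of `ℕ^ι`. -/
def cartesian {ι : Type*} (s : Set ι) (I₁ : Set (s → ℕ)) (I₂ : Set ((sᶜ : Set ι) → ℕ)) :
    Set (ι → ℕ) :=
  {x | (fun i : s => x i) ∈ I₁ ∧ (fun i : (sᶜ : Set ι) => x i) ∈ I₂}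

/-- `(T, S)` is, up to the order of the coordinates, a Cartesian product of two pairs of lower
(positive) dimension. -/
def IsCartesianProduct {ι : Type*} (T S : Set (ι → ℕ)) : Prop :=
  ∃ s : Set ι, s.Nonempty ∧ sᶜ.Nonempty ∧
    ∃ (I₁ J₁ : Set (s → ℕ)) (I₂ J₂ : Set ((sᶜ : Set ι) → ℕ)),
      IsNPair I₁ J₁ ∧ IsNPair I₂ J₂ ∧ T = cartesian s I₁ I₂ ∧ S = cartesian s J₁ J₂

/-- `(T, S)` is a primitive `ℕ^ι`-pair. -/
def IsPrimitiveNPair {ι : Type*} (T S : Set (ι → ℕ)) : Prop :=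
  IsNPair T S ∧ ¬ IsCartesianProduct T S

/-- A rooted tree with node set `V`. -/
structure RootedTree (V : Type*) where
  graph : SimpleGraph V
  isTree : graph.IsTree
  root : V

namespace RootedTree

variable {V : Type*} (Γ : RootedTree V)

/-- The level of a node: the length of the path joining it to the root. -/
noncomputable def level (v : V) : ℕ := Γ.graph.dist Γ.root v

/-- The set of offsprings of `u`. -/
def offspring (u : V) : Set V := {v | Γ.graph.Adj u v ∧ Γ.level v = Γ.level u + 1}

/-- A top is a node without offspring. -/
def IsTop (v : V) : Prop := Γ.offspring v = ∅

/-- Every node that is not a top has at least two offsprings. -/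
def IsBranching : Prop := ∀ v, ¬ Γ.IsTop v → (Γ.offspring v).Nontrivial

end RootedTree

/-- A weight of a rooted tree. The maps `α`, `C`, `D`, `size` matter only at nodes other than the
root, and `δ` only at nodes that are not tops; the values elsewhere are neither constrained nor
used. `Φ v = (C v, D v)` is the interval pair attached to `v`, and `size v` is its size. -/
structure Weight {V : Type*} (Γ : RootedTree V) where
  T₀ : Set ℕ
  S₀ : Set ℕ
  initial : IsPairOf Set.univ T₀ S₀
  δ : V → Fin 2
  α : V → ℕ
  C : V → Set ℕ
  D : V → Set ℕ
  size : V → ℕ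
  α_pos : ∀ v, v ≠ Γ.root → 0 < α v
  interval : ∀ v, v ≠ Γ.root → IsIntervalPair (size v) (C v) (D v)
  δ_root_of_left : ¬ Γ.IsTop Γ.root → T₀ = {0} → δ Γ.root = 1
  δ_root_of_right : ¬ Γ.IsTop Γ.root → S₀ = {0} → δ Γ.root = 0

section Generation

variable {V : Type*}

/-- The set with power series `∏_{v ∈ B} (C v)(v)`; the nodes are used as variables, and a monomial
in them is identified with its exponent vector in `V → ℕ`. -/
def box (B : Set V) (C : V → Set ℕ) : Set (V → ℕ) :=
  {y | (∀ v ∈ B, y v ∈ C v) ∧ ∀ v ∉ B, y v = 0}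

/-- `L_a = ℕ^B ∖ (ℕ^B + a)`, in the variables of `B`. -/
def corner (B : Set V) (a : V → ℕ) : Set (V → ℕ) :=
  {y | (∀ v ∉ B, y v = 0) ∧ ¬ ∀ v ∈ B, a v ≤ y v}

/-- The set with power series `L_a^ε` evaluated at `v ↦ v ^ N v`, for `ε ∈ {0, 1}`. -/
def cornerPow (B : Set V) (a N : V → ℕ) (ε : Fin 2) : Set (V → ℕ) :=
  if ε = 1 then (fun y v => N v * y v) '' corner B a else {0}

open Classical in
/-- The effect on exponent vectors of the substitution `z ↦ ∏_{v ∈ B} v ^ b v`. -/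
noncomputable def substitute (z : V) (B : Set V) (b : V → ℕ) (t : V → ℕ) : V → ℕ :=
  fun v => if v ∈ B then t z * b v else if v = z then 0 else t v

/-- The set with power series
`(∏_{v ∈ B} (C v)(v)) * L_a^ε (v ^ N v : v ∈ B) * T(z ↦ ∏_{v ∈ B} v ^ (a v * N v))`:
a second type extension along the variable `z`, with parameters `ε` and `a`, followed by
first type extensions along all the variables in `B`. A product of power series with
coefficients in `{0, 1}` corresponds to a sum of sets. -/
noncomputable def extend (z : V) (B : Set V) (C : V → Set ℕ) (a N : V → ℕ) (ε : Fin 2)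
    (T : Set (V → ℕ)) : Set (V → ℕ) :=
  box B C + cornerPow B a N ε + substitute z B (fun v => a v * N v) '' T

/-- `Generates W U T S`: the pair `(T, S)`, in the variables the tops of the subtree with node set
`U`, is generated by this subtree with the restricted weight. The definition is by recursion on the
subtree: the subtree consisting of the root alone generates the initial pair; otherwise one chooses
a node `z` of the subtree that is not a top in it and all of whose offsprings are tops in it,
removes the offsprings of `z`, and extends the pair generated by the smaller subtree. The set `U`
runs over the node sets that arise from `V` by such removals. -/
inductive Generates {Γ : RootedTree V} (W : Weight Γ) :
    Set V → Set (V → ℕ) → Set (V → ℕ) → Prop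
  | root : Generates W {Γ.root} (box {Γ.root} fun _ => W.T₀) (box {Γ.root} fun _ => W.S₀)
  | branch (U : Set V) (z : V) (T S : Set (V → ℕ)) (mem : z ∈ U)
      (nonempty : (Γ.offspring z).Nonempty) (subset : Γ.offspring z ⊆ U)
      (tops : ∀ x ∈ Γ.offspring z, Disjoint (Γ.offspring x) U)
      (ih : Generates W (U \ Γ.offspring z) T S) :
      Generates W U
        (extend z (Γ.offspring z) W.C W.α W.size (W.δ z) T)
        (extend z (Γ.offspring z) W.D W.α W.size (1 - W.δ z) S)

/-- The weighted tree `(Γ, W)`, whose tops are listed as `x₁, …, xₙ` by `e`, generates the pair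
`(T, S)` of subsets of `ℕ^n`. -/
def IsGeneratedBy {Γ : RootedTree V} (W : Weight Γ) {n : ℕ} (e : Fin n ≃ {v // Γ.IsTop v})
    (T S : Set (Fin n → ℕ)) : Prop :=
  ∃ T' S' : Set (V → ℕ), Generates W Set.univ T' S' ∧
    T = (fun y i => y (e i)) '' T' ∧ S = (fun y i => y (e i)) '' S'

end Generation

end NPair

/-!
An `ℕ^X`-pair is primitive when it splits along no proper subset of `X`.

*Extensions preserve primitivity.* One member of an extension of `(T, S)` has the corner `L_a` as a
factor, and `L_a` involves all the new variables. A splitting of the extension therefore cannot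
separate the new variables, provided that `z` occurs in the member which is not multiplied by `L_a`,
and it then descends to `(T, S)`. In a primitive pair in at least two variables every variable `z`
occurs in both members: if `z` did not occur in `T`, the fibres of `S` over the powers of `z` would
all complement `T`, hence be equal, and `z` would split off.

*Primitive pairs are extensions.* Take a minimal set `B` of variables on whose face `T` and `S` are
not both the products of their axes. Undoing first type extensions along `B`, whose sizes are
bounded because no variable splits off, one may assume that each axis of `B` lies in `T` or in `S`.
By minimality all of them lie in the same member, say `T`, and the least nonzero point of `S` on the
face of `B` is the vertex `a` of a corner `L_a ⊆ T`. Induction over the translates of this corner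
shows that `(T, S)` is a second type extension along `B` of a pair in which one variable `z`
replaces those of `B`. That pair is again primitive, so by induction it comes from a weighted tree,
and grafting `B` onto the top `z` gives a tree for `(T, S)`.
-/

namespace NPair

/-! ### Pairs, faces and splittings -/

section Pairs

variable {M M' : Type*} [AddCommMonoid M] [AddCommMonoid M'] {X A B : Set M}

theorem IsPairOf.exists_add (h : IsPairOf X A B) {c : M} (hc : c ∈ X) :
    ∃ a ∈ A, ∃ b ∈ B, a + b = c :=
  Set.mem_add.1 (h.add_eq ▸ hc)

theorem IsPairOf.add_mem (h : IsPairOf X A B) {a b : M} (ha : a ∈ A) (hb : b ∈ B) : a + b ∈ X :=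
  h.add_eq ▸ Set.add_mem_add ha hb

theorem IsPairOf.eq_and_eq (h : IsPairOf X A B) {a a' b b' : M} (ha : a ∈ A) (ha' : a' ∈ A)
    (hb : b ∈ B) (hb' : b' ∈ B) (e : a + b = a' + b') : a = a' ∧ b = b' :=
  Prod.mk.inj (h.direct (Set.mk_mem_prod ha hb) (Set.mk_mem_prod ha' hb') e)

theorem IsPairOf.of_exists_unique (hA : A ⊆ X) (hB : B ⊆ X)
    (hadd : ∀ a ∈ A, ∀ b ∈ B, a + b ∈ X) (hex : ∀ c ∈ X, ∃ a ∈ A, ∃ b ∈ B, a + b = c)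
    (huniq : ∀ a ∈ A, ∀ a' ∈ A, ∀ b ∈ B, ∀ b' ∈ B, a + b = a' + b' → a = a' ∧ b = b') :
    IsPairOf X A B where
  left_subset := hA
  right_subset := hB
  add_eq := (Set.add_subset_iff.2 hadd).antisymm fun c hc => Set.mem_add.2 (hex c hc)
  direct := by
    rintro ⟨a, b⟩ ⟨ha, hb⟩ ⟨a', b'⟩ ⟨ha', hb'⟩ e
    exact Prod.mk.injEq .. ▸ huniq a ha a' ha' b hb b' hb' e

theorem IsPairOf.symm (h : IsPairOf X A B) : IsPairOf X B A := by
  refine .of_exists_unique h.right_subset h.left_subset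
    (fun b hb a ha => add_comm a b ▸ h.add_mem ha hb) (fun c hc => ?_) ?_
  · obtain ⟨a, ha, b, hb, e⟩ := h.exists_add hc
    exact ⟨b, hb, a, ha, by rw [add_comm, e]⟩
  · intro b hb b' hb' a ha a' ha' e
    exact (h.eq_and_eq ha ha' hb hb' (by rw [add_comm a, add_comm a', e])).symm

theorem IsPairOf.zero_mem [Subsingleton (AddUnits M)] (h : IsPairOf X A B) (h0 : 0 ∈ X) :
    0 ∈ A := by
  obtain ⟨a, ha, b, -, e⟩ := h.exists_add h0
  rwa [← (add_eq_zero.1 e).1]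

theorem IsPairOf.eq_zero (h : IsPairOf X A B) (hA : 0 ∈ A) (hB : 0 ∈ B) {x : M} (hxA : x ∈ A)
    (hxB : x ∈ B) : x = 0 :=
  (h.eq_and_eq hxA hA hB hxB (by rw [add_zero, zero_add])).1

theorem isPairOf_self_zero (h0 : 0 ∈ X) : IsPairOf X X {0} := by
  refine .of_exists_unique subset_rfl (by simpa using h0) ?_ ?_ ?_
  · rintro a ha _ rfl
    rwa [add_zero]
  · exact fun c hc => ⟨c, hc, 0, rfl, add_zero c⟩
  · rintro a - a' - _ rfl _ rfl e
    simpa using e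

theorem IsPairOf.add {P L C D : Set M} (h : IsPairOf X P L) (hP : IsPairOf P A B)
    (hL : IsPairOf L C D) : IsPairOf X (A + C) (B + D) := by
  refine .of_exists_unique ?_ ?_ ?_ (fun x hx => ?_) ?_
  · exact Set.add_subset_iff.2 fun a ha c hc => h.add_mem (hP.left_subset ha) (hL.left_subset hc)
  · exact Set.add_subset_iff.2 fun b hb d hd =>
      h.add_mem (hP.right_subset hb) (hL.right_subset hd)
  · rintro _ ⟨a, ha, c, hc, rfl⟩ _ ⟨b, hb, d, hd, rfl⟩
    rw [add_add_add_comm]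
    exact h.add_mem (hP.add_mem ha hb) (hL.add_mem hc hd)
  · obtain ⟨p, hp, l, hl, rfl⟩ := h.exists_add hx
    obtain ⟨a, ha, b, hb, rfl⟩ := hP.exists_add hp
    obtain ⟨c, hc, d, hd, rfl⟩ := hL.exists_add hl
    exact ⟨_, Set.add_mem_add ha hc, _, Set.add_mem_add hb hd, add_add_add_comm a c b d⟩
  · rintro _ ⟨a, ha, c, hc, rfl⟩ _ ⟨a', ha', c', hc', rfl⟩ _ ⟨b, hb, d, hd, rfl⟩ _
      ⟨b', hb', d', hd', rfl⟩ e
    rw [add_add_add_comm, add_add_add_comm a'] at e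
    obtain ⟨e₁, e₂⟩ := h.eq_and_eq (hP.add_mem ha hb) (hP.add_mem ha' hb') (hL.add_mem hc hd)
      (hL.add_mem hc' hd') e
    obtain ⟨rfl, rfl⟩ := hP.eq_and_eq ha ha' hb hb' e₁
    obtain ⟨rfl, rfl⟩ := hL.eq_and_eq hc hc' hd hd' e₂
    exact ⟨rfl, rfl⟩

theorem IsPairOf.add_iff {P L C D : Set M} (h : IsPairOf X P L) (hL : IsPairOf L C D)
    (hC : 0 ∈ C) (hD : 0 ∈ D) (hA : A ⊆ P) (hB : B ⊆ P) (hAB : A + B ⊆ P) :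
    IsPairOf X (A + C) (B + D) ↔ IsPairOf P A B := by
  refine ⟨fun h' => ?_, fun hP => h.add hP hL⟩
  have hL0 : 0 ∈ L := hL.left_subset hC
  refine .of_exists_unique hA hB (Set.add_subset_iff.1 hAB) (fun p hp => ?_) ?_
  · have hpX : p ∈ X := by simpa using h.add_mem hp hL0
    obtain ⟨_, ⟨a, ha, c, hc, rfl⟩, _, ⟨b, hb, d, hd, rfl⟩, e⟩ := h'.exists_add hpX
    refine ⟨a, ha, b, hb, ?_⟩
    refine (h.eq_and_eq (hAB (Set.add_mem_add ha hb)) hp (hL.add_mem hc hd) hL0 ?_).1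
    rw [← add_add_add_comm, add_zero]
    exact e
  · intro a ha a' ha' b hb b' hb' e
    have hmem : ∀ {E F : Set M} {x : M}, 0 ∈ F → x ∈ E → x ∈ E + F := fun h0 hx =>
      Set.mem_add.2 ⟨_, hx, 0, h0, add_zero _⟩
    exact h'.eq_and_eq (hmem hC ha) (hmem hC ha') (hmem hD hb) (hmem hD hb') e

theorem isPairOf_image_iff {φ : M →+ M'} (hφ : Set.InjOn φ X) (hA : A ⊆ X) (hB : B ⊆ X)
    (hAB : A + B ⊆ X) : IsPairOf (φ '' X) (φ '' A) (φ '' B) ↔ IsPairOf X A B := by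
  have add_mem {a b : M} (ha : a ∈ A) (hb : b ∈ B) : a + b ∈ X := hAB (Set.add_mem_add ha hb)
  constructor <;> intro h
  · refine .of_exists_unique hA hB (fun a ha b => add_mem ha) (fun c hc => ?_) ?_
    · obtain ⟨_, ⟨a, ha, rfl⟩, _, ⟨b, hb, rfl⟩, e⟩ := h.exists_add (Set.mem_image_of_mem φ hc)
      exact ⟨a, ha, b, hb, hφ (add_mem ha hb) hc (by rw [map_add, e])⟩
    · intro a ha a' ha' b hb b' hb' e
      obtain ⟨e₁, e₂⟩ := h.eq_and_eq (Set.mem_image_of_mem φ ha) (Set.mem_image_of_mem φ ha')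
        (Set.mem_image_of_mem φ hb) (Set.mem_image_of_mem φ hb') (by rw [← map_add, e, map_add])
      exact ⟨hφ (hA ha) (hA ha') e₁, hφ (hB hb) (hB hb') e₂⟩
  · refine .of_exists_unique (Set.image_mono hA) (Set.image_mono hB) ?_ ?_ ?_
    · rintro _ ⟨a, ha, rfl⟩ _ ⟨b, hb, rfl⟩
      exact ⟨a + b, add_mem ha hb, map_add φ a b⟩
    · rintro _ ⟨c, hc, rfl⟩
      obtain ⟨a, ha, b, hb, rfl⟩ := h.exists_add hc
      exact ⟨_, ⟨a, ha, rfl⟩, _, ⟨b, hb, rfl⟩, (map_add φ a b).symm⟩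
    · rintro _ ⟨a, ha, rfl⟩ _ ⟨a', ha', rfl⟩ _ ⟨b, hb, rfl⟩ _ ⟨b', hb', rfl⟩ e
      rw [← map_add, ← map_add] at e
      obtain ⟨rfl, rfl⟩ := h.eq_and_eq ha ha' hb hb' (hφ (add_mem ha hb) (add_mem ha' hb') e)
      exact ⟨rfl, rfl⟩

theorem IsPairOf.preimage (h : IsPairOf X A B) {φ : M' →+ M} (hφ : Function.Injective φ)
    (hrange : ∀ a b, a + b ∈ Set.range φ → a ∈ Set.range φ ∧ b ∈ Set.range φ) :
    IsPairOf (φ ⁻¹' X) (φ ⁻¹' A) (φ ⁻¹' B) := by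
  refine .of_exists_unique (Set.preimage_mono h.left_subset) (Set.preimage_mono h.right_subset)
    (fun a ha b hb => ?_) (fun c hc => ?_) fun a ha a' ha' b hb b' hb' e => ?_
  · rw [Set.mem_preimage, map_add]
    exact h.add_mem ha hb
  · obtain ⟨a, ha, b, hb, e⟩ := h.exists_add hc
    obtain ⟨⟨a, rfl⟩, b, rfl⟩ := hrange a b ⟨c, e.symm⟩
    exact ⟨a, ha, b, hb, hφ (by rw [map_add, e])⟩
  · have := h.eq_and_eq ha ha' hb hb' (by rw [← map_add, e, map_add])
    exact ⟨hφ this.1, hφ this.2⟩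

theorem IsIntervalPair.symm {N : ℕ} {C D : Set ℕ} (h : IsIntervalPair N C D) :
    IsIntervalPair N D C := ⟨h.one_le_size, h.pair.symm⟩

theorem IsIntervalPair.zero_mem {N : ℕ} {C D : Set ℕ} (h : IsIntervalPair N C D) : 0 ∈ C :=
  h.pair.zero_mem h.one_le_size

theorem isIntervalPair_Iio {n : ℕ} (hn : 1 ≤ n) : IsIntervalPair n (Set.Iio n) {0} :=
  ⟨hn, isPairOf_self_zero hn⟩

theorem isIntervalPair_one : IsIntervalPair 1 {0} {0} := by
  have : Set.Iio 1 = ({0} : Set ℕ) := Set.ext fun _ => Nat.lt_one_iff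
  exact this ▸ isIntervalPair_Iio le_rfl

theorem IsIntervalPair.eq_singleton_zero {C D : Set ℕ} (h : IsIntervalPair 1 C D) : C = {0} :=
  Set.Subset.antisymm (fun _ hc => Nat.lt_one_iff.1 (h.pair.left_subset hc))
    (Set.singleton_subset_iff.2 h.zero_mem)

end Pairs

section Faces

variable {ι κ : Type*} {X : Set ι} {f : κ → ι}

/-- The face of `ℕ^ι` spanned by the coordinates in `X`. Pairs of subsets of `ℕ^X` are encoded as
pairs of subsets of this face, so that `X` can vary inside a fixed type. -/
def face (X : Set ι) : AddSubmonoid (ι → ℕ) where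
  carrier := {x | ∀ i ∉ X, x i = 0}
  zero_mem' _ _ := rfl
  add_mem' hx hy i hi := by rw [Pi.add_apply, hx i hi, hy i hi]

theorem mem_face_of_le {x y : ι → ℕ} (hx : x ∈ face X) (h : y ≤ x) : y ∈ face X :=
  fun i hi => Nat.le_zero.1 ((h i).trans (hx i hi).le)

theorem indicator_mem_face {x : ι → ℕ} (hx : x ∈ face X) (s : Set ι) : s.indicator x ∈ face X :=
  mem_face_of_le hx (Set.indicator_le_self s x)

theorem coe_face_univ : (face (Set.univ : Set ι) : Set (ι → ℕ)) = Set.univ :=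
  Set.eq_univ_of_forall fun _ i hi => absurd (Set.mem_univ i) hi

theorem IsPairOf.zero_mem_of_face {T S : Set (ι → ℕ)} (h : IsPairOf (face X) T S) : 0 ∈ T :=
  h.zero_mem (face X).zero_mem

/-- The extension of exponent vectors by zero along a map of the index sets. -/
noncomputable abbrev extendZero (f : κ → ι) : (κ → ℕ) →+ (ι → ℕ) := Function.ExtendByZero.hom ℕ f

theorem extendZero_apply (hf : Function.Injective f) (y : κ → ℕ) (k : κ) :
    extendZero f y (f k) = y k := hf.extend_apply y (0 : ι → ℕ) k

theorem extendZero_notMem (y : κ → ℕ) {i : ι} (hi : i ∉ Set.range f) : extendZero f y i = 0 :=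
  Function.extend_apply' y (0 : ι → ℕ) i hi

theorem extendZero_injective (hf : Function.Injective f) : Function.Injective (extendZero f) :=
  Function.extend_injective hf (0 : ι → ℕ)

theorem extendZero_comp (hf : Function.Injective f) {x : ι → ℕ} (hx : x ∈ face (Set.range f)) :
    extendZero f (x ∘ f) = x := by
  ext i
  by_cases hi : i ∈ Set.range f
  · obtain ⟨k, rfl⟩ := hi
    exact extendZero_apply hf _ k
  · rw [extendZero_notMem _ hi, hx i hi]

theorem range_extendZero (hf : Function.Injective f) :
    Set.range (extendZero f) = face (Set.range f) :=
  Set.Subset.antisymm (Set.range_subset_iff.2 fun y _ hi => extendZero_notMem y hi)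
    fun x hx => ⟨x ∘ f, extendZero_comp hf hx⟩

theorem extendZero_restrict (s : Set ι) (x : ι → ℕ) :
    extendZero (Subtype.val : s → ι) (fun i => x i) = s.indicator x := by
  have hx : s.indicator x ∈ face (Set.range (Subtype.val : s → ι)) := by
    rw [Subtype.range_coe]
    exact fun i hi => Set.indicator_of_notMem hi x
  rw [← extendZero_comp Subtype.val_injective hx]
  congr 1
  ext i
  exact (Set.indicator_of_mem i.2 x).symm

theorem preimage_extendZero (hf : Function.Injective f) {T : Set (ι → ℕ)}
    (hT : T ⊆ face (Set.range f)) : extendZero f ⁻¹' T = (· ∘ f) '' T := by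
  ext y
  constructor
  · exact fun hy => ⟨_, hy, funext (extendZero_apply hf y)⟩
  · rintro ⟨x, hx, rfl⟩
    rwa [Set.mem_preimage, extendZero_comp hf (hT hx)]

theorem IsPairOf.preimage_extendZero {X T S : Set (ι → ℕ)} (h : IsPairOf X T S)
    (hf : Function.Injective f) :
    IsPairOf (extendZero f ⁻¹' X) (extendZero f ⁻¹' T) (extendZero f ⁻¹' S) := by
  refine h.preimage (extendZero_injective hf) fun a b hab => ?_
  rw [range_extendZero hf] at hab ⊢
  exact ⟨mem_face_of_le hab le_self_add, mem_face_of_le hab le_add_self⟩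

end Faces

section Splitting

variable {ι κ : Type*} {X s : Set ι} {T S : Set (ι → ℕ)}

/-- The set `T` is the product of its intersections with the faces of `s` and `sᶜ`. -/
def SplitsAt (s : Set ι) (T : Set (ι → ℕ)) : Prop :=
  ∀ x, x ∈ T ↔ s.indicator x ∈ T ∧ sᶜ.indicator x ∈ T

theorem SplitsAt.compl (h : SplitsAt s T) : SplitsAt sᶜ T := by
  intro x
  rw [compl_compl, and_comm]
  exact h x

theorem splitsAt_of_forall_mem_face (hT : T ⊆ face X)
    (h : ∀ x ∈ face X, x ∈ T ↔ s.indicator x ∈ T ∧ sᶜ.indicator x ∈ T) : SplitsAt s T := by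
  intro x
  by_cases hx : x ∈ face X
  · exact h x hx
  · refine iff_of_false (fun hc => hx (hT hc)) fun ⟨h₁, h₂⟩ => hx ?_
    rw [← Set.indicator_self_add_compl s x]
    exact (face X).add_mem (hT h₁) (hT h₂)

theorem indicator_eq_indicator_of_mem_face {x : ι → ℕ} (hx : x ∈ face X) {s' : Set ι}
    (hs : s ∩ X = s' ∩ X) : s.indicator x = s'.indicator x := by
  classical
  ext i
  by_cases hi : i ∈ X
  · have : i ∈ s ↔ i ∈ s' := by simpa [hi] using Set.ext_iff.1 hs i
    simp only [Set.indicator_apply, this]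
  · simp only [Set.indicator_apply, hx i hi, ite_self]

theorem SplitsAt.congr (h : SplitsAt s T) (hT : T ⊆ face X) {s' : Set ι}
    (hs : s ∩ X = s' ∩ X) : SplitsAt s' T := by
  refine splitsAt_of_forall_mem_face hT fun x hx => ?_
  have hsc : sᶜ ∩ X = s'ᶜ ∩ X := by
    rw [Set.inter_comm, ← Set.sdiff_eq, Set.inter_comm, ← Set.sdiff_eq,
      ← Set.sdiff_inter_self_eq_sdiff, hs, Set.sdiff_inter_self_eq_sdiff]
  rw [← indicator_eq_indicator_of_mem_face hx hs, ← indicator_eq_indicator_of_mem_face hx hsc]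
  exact h x

theorem SplitsAt.eq_cartesian (h : SplitsAt s T) :
    T = cartesian s (extendZero Subtype.val ⁻¹' T) (extendZero Subtype.val ⁻¹' T) := by
  ext x
  simp only [cartesian, Set.mem_ofPred_eq, Set.mem_preimage, extendZero_restrict]
  exact h x

theorem splitsAt_cartesian {I : Set (s → ℕ)} {J : Set ((sᶜ : Set ι) → ℕ)}
    (h0 : 0 ∈ cartesian s I J) : SplitsAt s (cartesian s I J) := by
  intro x
  have mem_compl : ∀ i : (sᶜ : Set ι), (i : ι) ∉ s := fun i => i.2
  have zero_mem : (fun _ : s => 0) ∈ I ∧ (fun _ : (sᶜ : Set ι) => 0) ∈ J := h0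
  simp [cartesian, Set.indicator, mem_compl, zero_mem]

theorem IsNPair.symm (h : IsNPair T S) : IsNPair S T := IsPairOf.symm h

theorem IsNPair.isCartesianProduct_iff (h : IsNPair T S) :
    IsCartesianProduct T S ↔
      ∃ s : Set ι, s.Nonempty ∧ sᶜ.Nonempty ∧ SplitsAt s T ∧ SplitsAt s S := by
  have h0 : (0 : ι → ℕ) ∈ Set.univ := Set.mem_univ 0
  constructor
  · rintro ⟨s, hs, hs', I₁, J₁, I₂, J₂, -, -, rfl, rfl⟩
    exact ⟨s, hs, hs', splitsAt_cartesian (IsPairOf.zero_mem h h0),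
      splitsAt_cartesian (IsPairOf.zero_mem (IsPairOf.symm h) h0)⟩
  · rintro ⟨s, hs, hs', hT, hS⟩
    exact ⟨s, hs, hs', _, _, _, _, IsPairOf.preimage_extendZero h Subtype.val_injective,
      IsPairOf.preimage_extendZero h Subtype.val_injective, hT.eq_cartesian, hS.eq_cartesian⟩

/-- `(T, S)` is a primitive pair in the variables of `X`. -/
structure IsPrimitiveOn (X : Set ι) (T S : Set (ι → ℕ)) : Prop where
  pair : IsPairOf (face X) T S
  not_splits : ∀ s : Set ι, (X ∩ s).Nonempty → (X \ s).Nonempty → ¬ (SplitsAt s T ∧ SplitsAt s S)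

theorem IsPrimitiveOn.symm (h : IsPrimitiveOn X T S) : IsPrimitiveOn X S T :=
  ⟨h.pair.symm, fun s hs hs' hST => h.not_splits s hs hs' hST.symm⟩

theorem isPrimitiveOn_univ_iff : IsPrimitiveOn Set.univ T S ↔ IsPrimitiveNPair T S := by
  have : IsPairOf (face (Set.univ : Set ι)) T S ↔ IsNPair T S := by
    rw [coe_face_univ, IsNPair]
  constructor
  · intro h
    have hp := this.1 h.pair
    refine ⟨hp, fun hc => ?_⟩
    obtain ⟨s, hs, hs', hST⟩ := hp.isCartesianProduct_iff.1 hc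
    exact h.not_splits s (by rwa [Set.univ_inter]) (by rwa [← Set.compl_eq_univ_sdiff]) hST
  · refine fun h => ⟨this.2 h.1, fun s hs hs' hST => h.2 ?_⟩
    rw [Set.univ_inter] at hs
    rw [← Set.compl_eq_univ_sdiff] at hs'
    exact h.1.isCartesianProduct_iff.2 ⟨s, hs, hs', hST⟩

theorem indicator_extendZero {f : κ → ι} (hf : Function.Injective f) (s : Set ι) (y : κ → ℕ) :
    s.indicator (extendZero f y) = extendZero f ((f ⁻¹' s).indicator y) := by
  classical
  ext i
  by_cases hi : i ∈ Set.range f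
  · obtain ⟨k, rfl⟩ := hi
    simp only [Set.indicator_apply, extendZero_apply hf, Set.mem_preimage]
  · simp only [Set.indicator_apply, extendZero_notMem _ hi, ite_self]

theorem splitsAt_preimage_extendZero_iff {f : κ → ι} (hf : Function.Injective f)
    (hT : T ⊆ face (Set.range f)) : SplitsAt (f ⁻¹' s) (extendZero f ⁻¹' T) ↔ SplitsAt s T := by
  have key (y : κ → ℕ) : (y ∈ extendZero f ⁻¹' T ↔ (f ⁻¹' s).indicator y ∈ extendZero f ⁻¹' T ∧
      (f ⁻¹' s)ᶜ.indicator y ∈ extendZero f ⁻¹' T) ↔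
      (extendZero f y ∈ T ↔
        s.indicator (extendZero f y) ∈ T ∧ sᶜ.indicator (extendZero f y) ∈ T) := by
    simp only [indicator_extendZero hf, Set.mem_preimage, Set.preimage_compl]
  refine ⟨fun h => splitsAt_of_forall_mem_face hT fun x hx => ?_, fun h y => (key y).2 (h _)⟩
  rw [← extendZero_comp hf hx]
  exact (key _).1 (h _)

theorem IsPrimitiveOn.preimage_extendZero {f : κ → ι} (hf : Function.Injective f)
    (h : IsPrimitiveOn (Set.range f) T S) :
    IsPrimitiveNPair (extendZero f ⁻¹' T) (extendZero f ⁻¹' S) := by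
  rw [← isPrimitiveOn_univ_iff]
  refine ⟨?_, fun s ⟨k, _, hk⟩ ⟨k', _, hk'⟩ hST => ?_⟩
  · have := h.pair.preimage_extendZero hf
    rwa [← range_extendZero hf, Set.preimage_range, ← coe_face_univ] at this
  · rw [← Set.preimage_image_eq s hf, splitsAt_preimage_extendZero_iff hf h.pair.left_subset,
      splitsAt_preimage_extendZero_iff hf h.pair.right_subset] at hST
    exact h.not_splits (f '' s) ⟨f k, ⟨k, rfl⟩, k, hk, rfl⟩
      ⟨f k', ⟨k', rfl⟩, by rwa [hf.mem_set_image]⟩ hST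

end Splitting

/-! ### Extensions preserve primitivity -/

section FirstExtension

variable {ι : Type*} {X s : Set ι} {N N' : ι → ℕ} {C C' D : ι → Set ℕ} {T S : Set (ι → ℕ)}

theorem eq_and_eq_of_mul_add_eq {n q q' r r' : ℕ} (hr : r < n) (hr' : r' < n)
    (e : n * q + r = n * q' + r') : q = q' ∧ r = r' := by
  have h := (Nat.div_mod_unique (by omega)).2 ⟨add_comm r (n * q), hr⟩
  have h' := (Nat.div_mod_unique (by omega)).2 ⟨add_comm r' (n * q'), hr'⟩
  rw [e] at h
  exact ⟨h.1.symm.trans h'.1, h.2.symm.trans h'.2⟩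

theorem isPairOf_Iio_mul {m n : ℕ} (hn : 0 < n) (hm : 0 < m) :
    IsPairOf (Set.Iio (n * m)) ((n * ·) '' Set.Iio m) (Set.Iio n) := by
  refine .of_exists_unique ?_ (Set.Iio_subset_Iio (Nat.le_mul_of_pos_right n hm)) ?_
    (fun c hc => ?_) ?_
  · rintro _ ⟨q, hq, rfl⟩
    exact Nat.mul_lt_mul_of_pos_left hq hn
  · rintro _ ⟨q, hq, rfl⟩ r hr
    calc n * q + r < n * q + n := Nat.add_lt_add_left hr _
      _ = n * (q + 1) := (Nat.mul_succ n q).symm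
      _ ≤ n * m := Nat.mul_le_mul_left n hq
  · exact ⟨_, ⟨c / n, Nat.div_lt_of_lt_mul hc, rfl⟩, c % n, Nat.mod_lt c hn, Nat.div_add_mod c n⟩
  · rintro _ ⟨q, -, rfl⟩ _ ⟨q', -, rfl⟩ r hr r' hr' e
    obtain ⟨rfl, rfl⟩ := eq_and_eq_of_mul_add_eq hr hr' e
    exact ⟨rfl, rfl⟩

theorem IsIntervalPair.mul {m n : ℕ} {A B A' B' : Set ℕ} (h : IsIntervalPair n A B)
    (h' : IsIntervalPair m A' B') :
    IsIntervalPair (n * m) {c | c % n ∈ A ∧ c / n ∈ A'} {c | c % n ∈ B ∧ c / n ∈ B'} := by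
  have eq_add {A B A' : Set ℕ} (h : IsIntervalPair n A B) :
      {c | c % n ∈ A ∧ c / n ∈ A'} = AddMonoidHom.mulLeft n '' A' + A := by
    ext c
    constructor
    · exact fun hc => ⟨_, ⟨_, hc.2, rfl⟩, _, hc.1, Nat.div_add_mod c n⟩
    · rintro ⟨_, ⟨q, hq, rfl⟩, r, hr, rfl⟩
      have hrn : r < n := h.pair.left_subset hr
      simpa [Nat.mod_eq_of_lt hrn, Nat.mul_add_div h.one_le_size, Nat.div_eq_of_lt hrn] using
        And.intro hr hq
  refine ⟨Nat.mul_pos h.one_le_size h'.one_le_size, ?_⟩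
  rw [eq_add h, eq_add h.symm]
  refine (isPairOf_Iio_mul h.one_le_size h'.one_le_size).add ?_ h.pair
  exact (isPairOf_image_iff (φ := AddMonoidHom.mulLeft n)
    (mul_right_injective₀ (Nat.one_le_iff_ne_zero.1 h.one_le_size)).injOn
    h'.pair.left_subset h'.pair.right_subset
    h'.pair.add_eq.subset).2 h'.pair

theorem isPairOf_pi {M : ι → Type*} [∀ i, AddCommMonoid (M i)] {X A B : ∀ i, Set (M i)}
    (h : ∀ i, IsPairOf (X i) (A i) (B i)) :
    IsPairOf (Set.univ.pi X) (Set.univ.pi A) (Set.univ.pi B) := by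
  refine .of_exists_unique (Set.pi_mono fun i _ => (h i).left_subset)
    (Set.pi_mono fun i _ => (h i).right_subset) ?_ (fun c hc => ?_) ?_
  · exact fun a ha b hb i hi => (h i).add_mem (ha i hi) (hb i hi)
  · choose a ha b hb e using fun i => (h i).exists_add (hc i trivial)
    exact ⟨a, fun i _ => ha i, b, fun i _ => hb i, funext e⟩
  · intro a ha a' ha' b hb b' hb' e
    have key i := (h i).eq_and_eq (ha i trivial) (ha' i trivial) (hb i trivial) (hb' i trivial)
      (congrFun e i)
    exact ⟨funext fun i => (key i).1, funext fun i => (key i).2⟩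

/-- The first type extension of `T` by the sets `C i` along all coordinates `i`: the set with power
series `(∏ᵢ (C i)(xᵢ)) * T(xᵢ ↦ xᵢ ^ N i)`, when `C i ⊆ {0, …, N i - 1}`. -/
def firstExtend (N : ι → ℕ) (C : ι → Set ℕ) (T : Set (ι → ℕ)) : Set (ι → ℕ) :=
  {x | (∀ i, x i % N i ∈ C i) ∧ x / N ∈ T}

theorem mul_mem_firstExtend_iff (hC : ∀ i, IsIntervalPair (N i) (C i) (D i)) {y : ι → ℕ} :
    N * y ∈ firstExtend N C T ↔ y ∈ T := by
  have hdiv : N * y / N = y := funext fun i => Nat.mul_div_cancel_left _ (hC i).one_le_size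
  have hmod (i : ι) : (N * y) i % N i ∈ C i := by
    simpa using (hC i).zero_mem
  exact (and_iff_right hmod).trans (iff_of_eq (congrArg (· ∈ T) hdiv))

theorem firstExtend_eq_add (hC : ∀ i, IsIntervalPair (N i) (C i) (D i)) :
    firstExtend N C T = AddMonoidHom.mulLeft N '' T + Set.univ.pi C := by
  ext x
  constructor
  · exact fun hx => ⟨_, ⟨_, hx.2, rfl⟩, fun i => x i % N i, fun i _ => hx.1 i,
      funext fun i => Nat.div_add_mod (x i) (N i)⟩
  · rintro ⟨_, ⟨y, hy, rfl⟩, r, hr, rfl⟩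
    have hrN (i : ι) : r i < N i := (hC i).pair.left_subset (hr i trivial)
    refine ⟨fun i => ?_, ?_⟩
    · simpa [Nat.mod_eq_of_lt (hrN i)] using hr i trivial
    · convert hy
      ext i
      simp [Nat.mul_add_div ((Nat.zero_le _).trans_lt (hrN i)), Nat.div_eq_of_lt (hrN i)]

theorem firstExtend_firstExtend : firstExtend N C (firstExtend N' C' T) =
    firstExtend (N * N') (fun i => {c | c % N i ∈ C i ∧ c / N i ∈ C' i}) T := by
  ext x
  have hdiv : x / N / N' = x / (N * N') := funext fun i => Nat.div_div_eq_div_mul _ _ _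
  simp only [firstExtend, Set.mem_ofPred_eq, Pi.mul_apply, Nat.mod_mul_right_mod,
    Nat.mod_mul_right_div_self, Pi.div_apply, hdiv, forall_and, and_assoc]

theorem firstExtend_one : firstExtend 1 (fun _ => {0}) T = T := by
  have hdiv (x : ι → ℕ) : x / 1 = x := funext fun i => Nat.div_one _
  simp [firstExtend, hdiv, Nat.mod_one]

theorem isPairOf_mulLeft_image_face (hN : ∀ i, 0 < N i) (hX : ∀ i ∉ X, N i = 1) :
    IsPairOf (face X) (AddMonoidHom.mulLeft N '' face X) (Set.univ.pi fun i => Set.Iio (N i)) := by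
  have hbox : Set.univ.pi (fun i => Set.Iio (N i)) ⊆ face X := fun r hr i hi =>
    Nat.lt_one_iff.1 (hX i hi ▸ hr i trivial)
  have hmul : ∀ y ∈ face X, N * y ∈ face X := fun y hy i hi => by
    rw [Pi.mul_apply, hy i hi, mul_zero]
  refine .of_exists_unique ?_ hbox ?_ (fun x hx => ?_) ?_
  · rintro _ ⟨y, hy, rfl⟩
    exact hmul y hy
  · rintro _ ⟨y, hy, rfl⟩ r hr
    exact (face X).add_mem (hmul y hy) (hbox hr)
  · refine ⟨_, ⟨x / N, fun i hi => ?_, rfl⟩, fun i => x i % N i, fun i _ => Nat.mod_lt _ (hN i),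
      funext fun i => Nat.div_add_mod (x i) (N i)⟩
    rw [Pi.div_apply, hx i hi, Nat.zero_div]
  · rintro _ ⟨y, -, rfl⟩ _ ⟨y', -, rfl⟩ r hr r' hr' e
    have key (i : ι) : y i = y' i ∧ r i = r' i :=
      eq_and_eq_of_mul_add_eq (hr i trivial) (hr' i trivial) (congrFun e i)
    obtain rfl : y = y' := funext fun i => (key i).1
    exact ⟨rfl, funext fun i => (key i).2⟩

theorem isPairOf_firstExtend_iff (hC : ∀ i, IsIntervalPair (N i) (C i) (D i))
    (hX : ∀ i ∉ X, N i = 1) (hT : T ⊆ face X) (hS : S ⊆ face X) :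
    IsPairOf (face X) (firstExtend N C T) (firstExtend N D S) ↔ IsPairOf (face X) T S := by
  have hN i := (hC i).one_le_size
  have hTS : T + S ⊆ face X := Set.add_subset_iff.2 fun t ht u hu =>
    (face X).add_mem (hT ht) (hS hu)
  have hinj : Set.InjOn (AddMonoidHom.mulLeft N) (face X) := fun y _ y' _ e =>
    funext fun i => Nat.eq_of_mul_eq_mul_left (hN i) (congrFun e i)
  rw [firstExtend_eq_add hC, firstExtend_eq_add fun i => (hC i).symm,
    (isPairOf_mulLeft_image_face hN hX).add_iff (isPairOf_pi fun i => (hC i).pair)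
      (fun i _ => (hC i).zero_mem) (fun i _ => (hC i).symm.zero_mem) (Set.image_mono hT)
      (Set.image_mono hS) (by rw [← Set.image_add]; exact Set.image_mono hTS),
    isPairOf_image_iff hinj hT hS hTS]

theorem splitsAt_firstExtend_iff (hC : ∀ i, IsIntervalPair (N i) (C i) (D i)) :
    SplitsAt s (firstExtend N C T) ↔ SplitsAt s T := by
  classical
  have indicator_div (s : Set ι) (x : ι → ℕ) : s.indicator x / N = s.indicator (x / N) := by
    ext i
    by_cases hi : i ∈ s <;> simp [hi]
  have indicator_mul (s : Set ι) (y : ι → ℕ) : s.indicator (N * y) = N * s.indicator y := by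
    ext i
    by_cases hi : i ∈ s <;> simp [hi]
  refine ⟨fun h y => ?_, fun h x => ?_⟩
  · have := h (N * y)
    rwa [indicator_mul, indicator_mul, mul_mem_firstExtend_iff hC, mul_mem_firstExtend_iff hC,
      mul_mem_firstExtend_iff hC] at this
  · have hmod : (∀ i, x i % N i ∈ C i) ↔ (∀ i, s.indicator x i % N i ∈ C i) ∧
        ∀ i, sᶜ.indicator x i % N i ∈ C i := by
      rw [← forall_and]
      refine forall_congr' fun i => ?_
      by_cases hi : i ∈ s <;> simp [hi, (hC i).zero_mem]
    simp only [firstExtend, Set.mem_ofPred_eq, hmod, h (x / N), indicator_div]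
    tauto

theorem isPrimitiveOn_firstExtend_iff (hC : ∀ i, IsIntervalPair (N i) (C i) (D i))
    (hX : ∀ i ∉ X, N i = 1) (hT : T ⊆ face X) (hS : S ⊆ face X) :
    IsPrimitiveOn X (firstExtend N C T) (firstExtend N D S) ↔ IsPrimitiveOn X T S := by
  have hsplit (s : Set ι) : SplitsAt s (firstExtend N C T) ∧ SplitsAt s (firstExtend N D S) ↔
      SplitsAt s T ∧ SplitsAt s S :=
    and_congr (splitsAt_firstExtend_iff hC) (splitsAt_firstExtend_iff fun i => (hC i).symm)
  have hpair := isPairOf_firstExtend_iff hC hX hT hS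
  exact ⟨fun h => ⟨hpair.1 h.pair, fun s hs hs' => mt (hsplit s).2 (h.not_splits s hs hs')⟩,
    fun h => ⟨hpair.2 h.pair, fun s hs hs' => mt (hsplit s).1 (h.not_splits s hs hs')⟩⟩

end FirstExtension

section SecondExtension

variable {V : Type*} {z : V} {B X s : Set V} {a : V → ℕ} {T S L : Set (V → ℕ)}

/-- The exponent vectors whose coordinates in `B` are a multiple of those of `a`. -/
def base (B : Set V) (a : V → ℕ) : AddSubmonoid (V → ℕ) where
  carrier := {x | ∃ k, ∀ v ∈ B, x v = k * a v}
  zero_mem' := ⟨0, fun _ _ => (zero_mul _).symm⟩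
  add_mem' := by
    rintro x y ⟨k, hk⟩ ⟨l, hl⟩
    exact ⟨k + l, fun v hv => by rw [Pi.add_apply, hk v hv, hl v hv, add_mul]⟩

theorem zero_mem_corner (hB : B.Nonempty) (ha : ∀ v ∈ B, 0 < a v) : 0 ∈ corner B a := by
  obtain ⟨v, hv⟩ := hB
  exact ⟨fun _ _ => rfl, fun h => (h v hv).not_gt (ha v hv)⟩

theorem mem_corner_of_le {l l' : V → ℕ} (hl : l ∈ corner B a) (h : l' ≤ l) : l' ∈ corner B a :=
  ⟨mem_face_of_le hl.1 h, fun hc => hl.2 fun v hv => (hc v hv).trans (h v)⟩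

theorem exists_base_add_corner (hB : B.Nonempty) (ha : ∀ v ∈ B, 0 < a v) (x : V → ℕ) :
    ∃ b ∈ base B a, ∃ l ∈ corner B a, b + l = x := by
  classical
  obtain ⟨j, hj, hmin⟩ := exists_minimalFor_of_wellFoundedLT (· ∈ B) (fun v => x v / a v) hB
  have le_div {v : V} (hv : v ∈ B) : x j / a j ≤ x v / a v := (le_total _ _).elim id (hmin hv)
  let b : V → ℕ := B.piecewise (fun v => x j / a j * a v) x
  have hbB {v : V} (hv : v ∈ B) : b v = x j / a j * a v := Set.piecewise_eq_of_mem _ _ _ hv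
  have hbBc {v : V} (hv : v ∉ B) : b v = x v := Set.piecewise_eq_of_notMem _ _ _ hv
  have hb : b ≤ x := fun v => by
    by_cases hv : v ∈ B
    · rw [hbB hv]
      exact (Nat.le_div_iff_mul_le (ha v hv)).1 (le_div hv)
    · exact (hbBc hv).le
  refine ⟨b, ⟨x j / a j, fun v => hbB⟩, x - b, ⟨fun v hv => ?_, fun hc => ?_⟩,
    add_tsub_cancel_of_le hb⟩
  · rw [Pi.sub_apply, hbBc hv, Nat.sub_self]
  · have hlt : x j - x j / a j * a j < a j := by
      rw [← Nat.mod_eq_sub_div_mul]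
      exact Nat.mod_lt _ (ha j hj)
    refine hlt.not_ge ?_
    simpa only [Pi.sub_apply, hbB hj] using hc j hj

theorem le_of_base_add_corner_le {b b' l l' : V → ℕ} (hb : b ∈ base B a) (hb' : b' ∈ base B a)
    (hl : l ∈ corner B a) (hl' : l' ∈ corner B a) (h : b' + l' ≤ b + l) : b' ≤ b := by
  obtain ⟨k, hk⟩ := hb
  obtain ⟨k', hk'⟩ := hb'
  obtain ⟨j, hj, hlj⟩ : ∃ j ∈ B, l j < a j := by simpa using hl.2
  have hkk' : k' ≤ k := by
    by_contra! hlt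
    have hj' : k' * a j + l' j ≤ k * a j + l j := hk j hj ▸ hk' j hj ▸ h j
    have : (k + 1) * a j ≤ k' * a j := Nat.mul_le_mul_right _ hlt
    rw [add_mul, one_mul] at this
    omega
  intro v
  by_cases hv : v ∈ B
  · rw [hk v hv, hk' v hv]
    exact Nat.mul_le_mul_right _ hkk'
  · simpa [hl.1 v hv, hl'.1 v hv] using h v

theorem eq_and_eq_of_base_add_corner_eq {b b' l l' : V → ℕ} (hb : b ∈ base B a)
    (hb' : b' ∈ base B a) (hl : l ∈ corner B a) (hl' : l' ∈ corner B a) (h : b + l = b' + l') :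
    b = b' ∧ l = l' := by
  obtain rfl : b = b' := le_antisymm (le_of_base_add_corner_le hb' hb hl' hl h.le)
    (le_of_base_add_corner_le hb hb' hl hl' h.ge)
  exact ⟨rfl, add_left_cancel h⟩

theorem isPairOf_base_corner (hB : B.Nonempty) (ha : ∀ v ∈ B, 0 < a v) (hBX : B ⊆ X) :
    IsPairOf (face X) (face X ⊓ base B a : AddSubmonoid _) (corner B a) := by
  have hcorner : corner B a ⊆ face X := fun l hl v hv => hl.1 v (mt (@hBX v) hv)
  refine .of_exists_unique (fun b hb => hb.1) hcorner
    (fun b hb l hl => (face X).add_mem hb.1 (hcorner hl)) (fun x hx => ?_)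
    fun b hb b' hb' l hl l' hl' => eq_and_eq_of_base_add_corner_eq hb.2 hb'.2 hl hl'
  obtain ⟨b, hb, l, hl, rfl⟩ := exists_base_add_corner hB ha x
  exact ⟨b, ⟨mem_face_of_le hx le_self_add, hb⟩, l, hl, rfl⟩

/-- The substitution `z ↦ ∏_{v ∈ B} v ^ a v` on exponent vectors, as a homomorphism. The node `z`
may belong to `B`, which allows the variable `z` to be reused for one of the new ones. -/
noncomputable def substituteHom (z : V) (B : Set V) (a : V → ℕ) : (V → ℕ) →+ (V → ℕ) where
  toFun := substitute z B a
  map_zero' := by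
    ext v
    simp [substitute]
  map_add' t t' := by
    ext v
    by_cases hv : v ∈ B
    · simp [substitute, hv, add_mul]
    · obtain rfl | hvz := eq_or_ne v z
      · simp [substitute, hv]
      · simp [substitute, hv, hvz]

theorem substituteHom_of_mem {v : V} (hv : v ∈ B) (t : V → ℕ) :
    substituteHom z B a t v = t z * a v := if_pos hv

theorem substituteHom_of_notMem {v : V} (hv : v ∉ B) (hvz : v ≠ z) (t : V → ℕ) :
    substituteHom z B a t v = t v := (if_neg hv).trans (if_neg hvz)

theorem substituteHom_self (hz : z ∉ B) (t : V → ℕ) : substituteHom z B a t z = 0 :=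
  (if_neg hz).trans (if_pos rfl)

theorem substituteHom_image_face (hz : z ∈ X) (hBX : B ∩ X ⊆ {z}) :
    substituteHom z B a '' face X = (face (X \ {z} ∪ B) ⊓ base B a : AddSubmonoid _) := by
  classical
  ext x
  constructor
  · rintro ⟨t, ht, rfl⟩
    refine ⟨fun v hv => ?_, t z, fun v hv => substituteHom_of_mem hv t⟩
    have hvB : v ∉ B := fun h => hv (.inr h)
    obtain rfl | hvz := eq_or_ne v z
    · exact substituteHom_self hvB t
    · rw [substituteHom_of_notMem hvB hvz]
      exact ht v fun h => hv (.inl ⟨h, hvz⟩)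
  · rintro ⟨hx, k, hk⟩
    refine ⟨fun v => if v = z then k else if v ∈ B then 0 else x v, fun v hv => ?_, ?_⟩
    · have hvz : v ≠ z := fun h => hv (h ▸ hz)
      by_cases hvB : v ∈ B
      · simp [hvz, hvB]
      · simpa [hvz, hvB] using hx v (by simp [hv, hvB])
    · ext v
      by_cases hvB : v ∈ B
      · rw [substituteHom_of_mem hvB, if_pos rfl, hk v hvB]
      obtain rfl | hvz := eq_or_ne v z
      · rw [substituteHom_self hvB, hx v (by simp [hvB])]
      · rw [substituteHom_of_notMem hvB hvz, if_neg hvz, if_neg hvB]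

theorem substituteHom_injOn_face (hB : B.Nonempty) (ha : ∀ v ∈ B, 0 < a v) (hBX : B ∩ X ⊆ {z}) :
    Set.InjOn (substituteHom z B a) (face X) := by
  intro t ht t' ht' e
  have hz : t z = t' z := by
    obtain ⟨v, hv⟩ := hB
    refine Nat.eq_of_mul_eq_mul_right (ha v hv) ?_
    rw [← substituteHom_of_mem hv t, e, substituteHom_of_mem hv]
  ext v
  obtain rfl | hvz := eq_or_ne v z
  · exact hz
  by_cases hvX : v ∈ X
  · have hvB : v ∉ B := fun h => hvz (hBX ⟨h, hvX⟩)
    rw [← substituteHom_of_notMem hvB hvz t, e, substituteHom_of_notMem hvB hvz]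
  · rw [ht v hvX, ht' v hvX]

theorem substituteHom_add_mem_iff (hB : B.Nonempty) (ha : ∀ v ∈ B, 0 < a v) (hBX : B ∩ X ⊆ {z})
    (hT : T ⊆ face X) (hL : L ⊆ corner B a) {t l : V → ℕ} (ht : t ∈ face X)
    (hl : l ∈ corner B a) :
    substituteHom z B a t + l ∈ substituteHom z B a '' T + L ↔ t ∈ T ∧ l ∈ L := by
  have mem_base (t : V → ℕ) : substituteHom z B a t ∈ base B a :=
    ⟨t z, fun v hv => substituteHom_of_mem hv t⟩
  refine ⟨?_, fun h => ⟨_, ⟨t, h.1, rfl⟩, l, h.2, rfl⟩⟩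
  rintro ⟨_, ⟨t', ht', rfl⟩, l', hl', e⟩
  obtain ⟨e', rfl⟩ :=
    eq_and_eq_of_base_add_corner_eq (mem_base t') (mem_base t) (hL hl') hl e
  obtain rfl := substituteHom_injOn_face hB ha hBX (hT ht') ht e'
  exact ⟨ht', hl'⟩

theorem indicator_substituteHom (hBs : B ⊆ s) (t : V → ℕ) :
    s.indicator (substituteHom z B a t) = substituteHom z B a ((insert z s).indicator t) := by
  ext v
  by_cases hv : v ∈ B
  · simp [hBs hv, substituteHom_of_mem hv]
  obtain rfl | hvz := eq_or_ne v z
  · by_cases hs : v ∈ s <;> simp [hs, substituteHom_self hv]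
  · by_cases hs : v ∈ s <;> simp [hs, hvz, substituteHom_of_notMem hv hvz]

theorem indicator_compl_substituteHom (hBs : B ⊆ s) (t : V → ℕ) :
    sᶜ.indicator (substituteHom z B a t) = substituteHom z B a ((insert z s)ᶜ.indicator t) := by
  ext v
  by_cases hv : v ∈ B
  · simp [hBs hv, substituteHom_of_mem hv]
  obtain rfl | hvz := eq_or_ne v z
  · by_cases hs : v ∈ s <;> simp [hs, substituteHom_self hv]
  · by_cases hs : v ∈ s <;> simp [hs, hvz, substituteHom_of_notMem hv hvz]

theorem splitsAt_image_substituteHom_add_iff (hz : z ∈ X) (hB : B.Nonempty)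
    (ha : ∀ v ∈ B, 0 < a v) (hBX : B ∩ X ⊆ {z}) (hT : T ⊆ face X) (h0 : 0 ∈ L)
    (hL : L ⊆ corner B a) (hBs : B ⊆ s) :
    SplitsAt s (substituteHom z B a '' T + L) ↔ SplitsAt (insert z s) T := by
  have hY : B ⊆ X \ {z} ∪ B := Set.subset_union_right
  have hpair := isPairOf_base_corner hB ha hY
  rw [← substituteHom_image_face hz hBX] at hpair
  have splits_iff {t l : V → ℕ} (ht : t ∈ face X) (hl : l ∈ corner B a) :
      (substituteHom z B a t + l ∈ substituteHom z B a '' T + L ↔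
        s.indicator (substituteHom z B a t + l) ∈ substituteHom z B a '' T + L ∧
        sᶜ.indicator (substituteHom z B a t + l) ∈ substituteHom z B a '' T + L) ↔
      (t ∈ T ∧ l ∈ L ↔ ((insert z s).indicator t ∈ T ∧ l ∈ L) ∧
        (insert z s)ᶜ.indicator t ∈ T) := by
    have hls : Function.support l ⊆ s := fun v hv =>
      by_contra fun h => hv (hl.1 v (mt (@hBs v) h))
    have hlsc : sᶜ.indicator l = 0 :=
      Set.indicator_eq_zero.2 (Set.disjoint_compl_right_iff_subset.2 hls)
    rw [Set.indicator_add', Set.indicator_add', Set.indicator_eq_self.2 hls, hlsc,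
      indicator_substituteHom hBs, indicator_compl_substituteHom hBs,
      substituteHom_add_mem_iff hB ha hBX hT hL ht hl,
      substituteHom_add_mem_iff hB ha hBX hT hL (indicator_mem_face ht _) hl,
      substituteHom_add_mem_iff hB ha hBX hT hL (indicator_mem_face ht _) (hL h0)]
    simp only [h0, and_true]
  constructor
  · refine fun h => splitsAt_of_forall_mem_face hT fun t ht => ?_
    simpa only [h0, and_true] using (splits_iff ht (hL h0)).1 (h _)
  · refine fun h => splitsAt_of_forall_mem_face (X := X \ {z} ∪ B) ?_ fun x hx => ?_
    · exact Set.add_subset_iff.2 fun x hx l hl => hpair.add_mem (Set.image_mono hT hx) (hL hl)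
    · obtain ⟨_, ⟨t, ht, rfl⟩, l, hl, rfl⟩ := hpair.exists_add hx
      refine (splits_iff ht hl).2 ?_
      rw [h t]
      tauto

/-- The second factor `L_a ^ ε` of a second type extension. -/
def cornerOrZero (B : Set V) (a : V → ℕ) (ε : Fin 2) : Set (V → ℕ) :=
  if ε = 1 then corner B a else {0}

theorem cornerOrZero_one : cornerOrZero B a 1 = corner B a := if_pos rfl

theorem cornerOrZero_zero : cornerOrZero B a 0 = {0} := if_neg zero_ne_one

theorem zero_mem_cornerOrZero (hB : B.Nonempty) (ha : ∀ v ∈ B, 0 < a v) (ε : Fin 2) :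
    0 ∈ cornerOrZero B a ε := by
  unfold cornerOrZero
  split_ifs
  · exact zero_mem_corner hB ha
  · rfl

theorem cornerOrZero_subset_corner (hB : B.Nonempty) (ha : ∀ v ∈ B, 0 < a v) (ε : Fin 2) :
    cornerOrZero B a ε ⊆ corner B a := by
  unfold cornerOrZero
  split_ifs
  · rfl
  · exact Set.singleton_subset_iff.2 (zero_mem_corner hB ha)

theorem isPairOf_cornerOrZero (hB : B.Nonempty) (ha : ∀ v ∈ B, 0 < a v) (ε : Fin 2) :
    IsPairOf (corner B a) (cornerOrZero B a ε) (cornerOrZero B a (1 - ε)) := by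
  have h := isPairOf_self_zero (zero_mem_corner hB ha)
  obtain rfl | rfl : ε = 0 ∨ ε = 1 := by omega
  · rw [cornerOrZero_zero, sub_zero, cornerOrZero_one]
    exact h.symm
  · rwa [cornerOrZero_one, sub_self, cornerOrZero_zero]

theorem isPairOf_substituteHom_add_iff (hz : z ∈ X) (hB : B.Nonempty) (ha : ∀ v ∈ B, 0 < a v)
    (hBX : B ∩ X ⊆ {z}) (hT : T ⊆ face X) (hS : S ⊆ face X) (ε : Fin 2) :
    IsPairOf (face (X \ {z} ∪ B)) (substituteHom z B a '' T + cornerOrZero B a ε)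
      (substituteHom z B a '' S + cornerOrZero B a (1 - ε)) ↔ IsPairOf (face X) T S := by
  have hpair := isPairOf_base_corner (a := a) hB ha (X := X \ {z} ∪ B) Set.subset_union_right
  rw [← substituteHom_image_face hz hBX] at hpair
  have hTS : T + S ⊆ face X := Set.add_subset_iff.2 fun t ht u hu =>
    (face X).add_mem (hT ht) (hS hu)
  rw [hpair.add_iff (isPairOf_cornerOrZero hB ha ε) (zero_mem_cornerOrZero hB ha ε)
      (zero_mem_cornerOrZero hB ha _) (Set.image_mono hT) (Set.image_mono hS)
      (by rw [← Set.image_add]; exact Set.image_mono hTS),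
    isPairOf_image_iff (substituteHom_injOn_face hB ha hBX) hT hS hTS]

theorem splitsAt_substituteHom_add_cornerOrZero_iff (hz : z ∈ X) (hB : B.Nonempty)
    (ha : ∀ v ∈ B, 0 < a v) (hBX : B ∩ X ⊆ {z}) (hT : T ⊆ face X) (ε : Fin 2) (hBs : B ⊆ s) :
    SplitsAt s (substituteHom z B a '' T + cornerOrZero B a ε) ↔ SplitsAt (insert z s) T :=
  splitsAt_image_substituteHom_add_iff hz hB ha hBX hT (zero_mem_cornerOrZero hB ha ε)
    (cornerOrZero_subset_corner hB ha ε) hBs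

theorem not_splitsAt_image_substituteHom (ha : ∀ v ∈ B, 0 < a v) (hT : ∃ t ∈ T, t z ≠ 0)
    {i j : V} (hi : i ∈ B) (his : i ∈ s) (hj : j ∈ B) (hjs : j ∉ s) :
    ¬ SplitsAt s (substituteHom z B a '' T) := by
  intro h
  obtain ⟨t, ht, htz⟩ := hT
  obtain ⟨t', -, e⟩ := ((h _).1 ⟨t, ht, rfl⟩).1
  have hej := congrFun e j
  have hei := congrFun e i
  rw [substituteHom_of_mem hj, Set.indicator_of_notMem hjs] at hej
  have ht'z : t' z = 0 := (Nat.mul_eq_zero.1 hej).resolve_right (ha j hj).ne'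
  rw [substituteHom_of_mem hi, Set.indicator_of_mem his, substituteHom_of_mem hi, ht'z,
    zero_mul] at hei
  exact mul_ne_zero htz (ha i hi).ne' hei.symm

theorem IsPrimitiveOn.substituteHom_add (h : IsPrimitiveOn X T S) (hz : z ∈ X) (hB : B.Nonempty)
    (ha : ∀ v ∈ B, 0 < a v) (hBX : B ∩ X ⊆ {z}) {ε : Fin 2} (hT : ε = 0 → ∃ t ∈ T, t z ≠ 0)
    (hS : ε = 1 → ∃ u ∈ S, u z ≠ 0) :
    IsPrimitiveOn (X \ {z} ∪ B) (substituteHom z B a '' T + cornerOrZero B a ε)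
      (substituteHom z B a '' S + cornerOrZero B a (1 - ε)) := by
  have not_splits_of_subset {s : Set V} (hBs : B ⊆ s) (hs : ((X \ {z} ∪ B) \ s).Nonempty) :
      ¬ (SplitsAt s (substituteHom z B a '' T + cornerOrZero B a ε) ∧
        SplitsAt s (substituteHom z B a '' S + cornerOrZero B a (1 - ε))) := by
    obtain ⟨v, ⟨hvX, hvz⟩ | hvB, hvs⟩ := hs
    · rw [splitsAt_substituteHom_add_cornerOrZero_iff hz hB ha hBX h.pair.left_subset _ hBs,
        splitsAt_substituteHom_add_cornerOrZero_iff hz hB ha hBX h.pair.right_subset _ hBs]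
      exact h.not_splits _ ⟨z, hz, Set.mem_insert z s⟩ ⟨v, hvX, not_or_intro hvz hvs⟩
    · exact absurd (hBs hvB) hvs
  refine ⟨(isPairOf_substituteHom_add_iff hz hB ha hBX h.pair.left_subset h.pair.right_subset ε).2
    h.pair, fun s ⟨x, hxY, hxs⟩ hs' hsplit => ?_⟩
  by_cases hBs : B ⊆ s
  · exact not_splits_of_subset hBs hs' hsplit
  by_cases hBsc : B ⊆ sᶜ
  · exact not_splits_of_subset hBsc ⟨x, hxY, not_not_intro hxs⟩ (hsplit.imp .compl .compl)
  obtain ⟨j, hj, hjs⟩ := Set.not_subset.1 hBs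
  obtain ⟨i, hi, his⟩ := Set.not_subset.1 hBsc
  have not_splits {R : Set (V → ℕ)} (hR : ∃ t ∈ R, t z ≠ 0) :
      ¬ SplitsAt s (substituteHom z B a '' R + {0}) := by
    rw [Set.add_singleton]
    simpa using not_splitsAt_image_substituteHom ha hR hi (not_not.1 his) hj hjs
  obtain rfl | rfl : ε = 0 ∨ ε = 1 := by omega
  · exact not_splits (hT rfl) (cornerOrZero_zero (B := B) (a := a) ▸ hsplit.1)
  · exact not_splits (hS rfl) (cornerOrZero_zero (B := B) (a := a) ▸ hsplit.2)

theorem IsPrimitiveOn.of_substituteHom_add (hz : z ∈ X) (hB : B.Nonempty)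
    (ha : ∀ v ∈ B, 0 < a v) (hBX : B ∩ X ⊆ {z}) (hT : T ⊆ face X) (hS : S ⊆ face X) {ε : Fin 2}
    (h : IsPrimitiveOn (X \ {z} ∪ B) (substituteHom z B a '' T + cornerOrZero B a ε)
      (substituteHom z B a '' S + cornerOrZero B a (1 - ε))) : IsPrimitiveOn X T S := by
  have not_splits_of_mem {s : Set V} (hzs : z ∈ s) (hs : (X \ s).Nonempty) :
      ¬ (SplitsAt s T ∧ SplitsAt s S) := by
    rintro ⟨hsT, hsS⟩
    obtain ⟨v, hvX, hvs⟩ := hs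
    obtain ⟨b, hb⟩ := hB
    have hvz : v ≠ z := fun e => hvs (e ▸ hzs)
    have hvB : v ∉ B := fun hv => hvz (hBX ⟨hv, hvX⟩)
    have hs : s ∩ X = insert z (s ∪ B) ∩ X := by
      refine Set.Subset.antisymm (fun i hi => ⟨.inr (.inl hi.1), hi.2⟩) ?_
      rintro i ⟨rfl | his | hiB, hiX⟩
      · exact ⟨hzs, hiX⟩
      · exact ⟨his, hiX⟩
      · exact ⟨(hBX ⟨hiB, hiX⟩ : i = z) ▸ hzs, hiX⟩
    refine h.not_splits (s ∪ B) ⟨b, .inr hb, .inr hb⟩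
      ⟨v, .inl ⟨hvX, hvz⟩, not_or_intro hvs hvB⟩ ⟨?_, ?_⟩
    · exact (splitsAt_substituteHom_add_cornerOrZero_iff hz ⟨b, hb⟩ ha hBX hT _
        Set.subset_union_right).2 (hsT.congr hT hs)
    · exact (splitsAt_substituteHom_add_cornerOrZero_iff hz ⟨b, hb⟩ ha hBX hS _
        Set.subset_union_right).2 (hsS.congr hS hs)
  refine ⟨(isPairOf_substituteHom_add_iff hz hB ha hBX hT hS ε).1 h.pair,
    fun s ⟨x, hxX, hxs⟩ hs hsplit => ?_⟩
  by_cases hzs : z ∈ s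
  · exact not_splits_of_mem hzs hs hsplit
  · exact not_splits_of_mem (s := sᶜ) hzs ⟨x, hxX, not_not_intro hxs⟩ (hsplit.imp .compl .compl)

end SecondExtension

section Extension

variable {V : Type*} {z : V} {B X : Set V} {a a' N N' : V → ℕ} {C C' D : V → Set ℕ} {ε : Fin 2}
  {T S : Set (V → ℕ)}

theorem extend_congr (ha : Set.EqOn a a' B) (hN : Set.EqOn N N' B) (hC : Set.EqOn C C' B) :
    extend z B C a N ε T = extend z B C' a' N' ε T := by
  have hbox : box B C = box B C' := Set.ext fun y =>
    and_congr_left' (forall₂_congr fun v hv => by rw [hC hv])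
  have hcorner : corner B a = corner B a' := Set.ext fun y =>
    and_congr_right' (not_congr (forall₂_congr fun v hv => by rw [ha hv]))
  have hpow : cornerPow B a N ε = cornerPow B a' N' ε := by
    unfold cornerPow
    rw [hcorner]
    congr 1
    refine Set.image_congr fun y hy => funext fun v => ?_
    by_cases hv : v ∈ B
    · simp only [hN hv]
    · simp only [hy.1 v hv, mul_zero]
  have hsubst : substitute z B (fun v => a v * N v) = substitute z B fun v => a' v * N' v := by
    ext t v
    by_cases hv : v ∈ B
    · simp only [substitute, hv, if_true, ha hv, hN hv]
    · simp only [substitute, hv, if_false]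
  unfold extend
  rw [hbox, hpow, hsubst]

theorem box_eq_pi (hC : ∀ v ∉ B, C v = {0}) : box B C = Set.univ.pi C := by
  ext y
  refine ⟨fun h v _ => ?_, fun h => ⟨fun v _ => h v trivial, fun v hv => ?_⟩⟩
  · by_cases hv : v ∈ B
    · exact h.1 v hv
    · rw [hC v hv]
      exact h.2 v hv
  · simpa [hC v hv] using h v trivial

theorem cornerPow_eq_image : cornerPow B a N ε = AddMonoidHom.mulLeft N '' cornerOrZero B a ε := by
  unfold cornerPow cornerOrZero
  split_ifs
  · rfl
  · simp

theorem substitute_eq_mul (hN : ∀ v ∉ B, N v = 1) (t : V → ℕ) :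
    substitute z B (fun v => a v * N v) t = N * substituteHom z B a t := by
  ext v
  by_cases hv : v ∈ B
  · rw [Pi.mul_apply, substituteHom_of_mem hv, substitute, if_pos hv]
    ring
  · rw [Pi.mul_apply, hN v hv, one_mul]
    exact (if_neg hv).trans (if_neg hv).symm

theorem extend_eq_firstExtend (hC : ∀ v, IsIntervalPair (N v) (C v) (D v))
    (hN : ∀ v ∉ B, N v = 1) : extend z B C a N ε T =
      firstExtend N C (substituteHom z B a '' T + cornerOrZero B a ε) := by
  have hC' : ∀ v ∉ B, C v = {0} := fun v hv => (hN v hv ▸ hC v).eq_singleton_zero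
  rw [firstExtend_eq_add hC, Set.image_add, Set.image_image, extend, box_eq_pi hC',
    cornerPow_eq_image]
  simp only [substitute_eq_mul hN, AddMonoidHom.coe_mulLeft]
  abel

theorem IsPrimitiveOn.extend (h : IsPrimitiveOn X T S) (hz : z ∈ X) (hB : B.Nonempty)
    (hBX : B ∩ X ⊆ {z}) (ha : ∀ v ∈ B, 0 < a v)
    (hC : ∀ v ∈ B, IsIntervalPair (N v) (C v) (D v)) (hT : ε = 0 → ∃ t ∈ T, t z ≠ 0)
    (hS : ε = 1 → ∃ u ∈ S, u z ≠ 0) :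
    IsPrimitiveOn (X \ {z} ∪ B) (extend z B C a N ε T) (extend z B D a N (1 - ε) S) := by
  classical
  have hCpw (v : V) : IsIntervalPair (B.piecewise N 1 v) (B.piecewise C (fun _ => {0}) v)
      (B.piecewise D (fun _ => {0}) v) := by
    by_cases hv : v ∈ B
    · simpa [hv] using hC v hv
    · simpa [hv] using isIntervalPair_one
  have hNpw {v : V} (hv : v ∉ B) : B.piecewise N 1 v = 1 := Set.piecewise_eq_of_notMem _ _ _ hv
  have eqOn {β : Type} (f g : V → β) : Set.EqOn f (B.piecewise f g) B :=
    (Set.piecewise_eqOn B f g).symm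
  rw [extend_congr (Set.eqOn_refl a B) (eqOn N 1) (eqOn C fun _ => {0}),
    extend_congr (Set.eqOn_refl a B) (eqOn N 1) (eqOn D fun _ => {0}),
    extend_eq_firstExtend hCpw fun v => hNpw,
    extend_eq_firstExtend (fun v => (hCpw v).symm) fun v => hNpw]
  have hext := h.substituteHom_add hz hB ha hBX hT hS
  exact (isPrimitiveOn_firstExtend_iff hCpw (fun v hv => hNpw fun h => hv (.inr h))
    hext.pair.left_subset hext.pair.right_subset).2 hext

end Extension

section Fiber

theorem IsPairOf.right_unique {M : Type*} [AddCommMonoid M] [PartialOrder M]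
    [IsOrderedCancelAddMonoid M] [CanonicallyOrderedAdd M] [WellFoundedLT M] {X A B B' : Set M}
    (h : IsPairOf X A B) (h' : IsPairOf X A B') (h0 : 0 ∈ A) : B = B' := by
  ext x
  induction x using WellFoundedLT.induction with
  | ind x ih =>
  have mem_of_mem {B B' : Set M} (h : IsPairOf X A B) (h' : IsPairOf X A B')
      (ih : ∀ y < x, y ∈ B' → y ∈ B) (hx : x ∈ B) : x ∈ B' := by
    obtain ⟨a, ha, b, hb, rfl⟩ := h'.exists_add (h.right_subset hx)
    obtain rfl | ha0 := eq_or_ne a 0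
    · rwa [zero_add]
    · have hlt : b < a + b := lt_add_of_pos_left b (pos_iff_ne_zero.2 ha0)
      exact absurd (h.eq_and_eq ha h0 (ih b hlt hb) hx (zero_add _).symm).1 ha0
  exact ⟨mem_of_mem h h' fun y hy => (ih y hy).2, mem_of_mem h' h fun y hy => (ih y hy).1⟩

variable {ι : Type*} {X : Set ι} {T S : Set (ι → ℕ)} {z : ι}

theorem mem_face_sdiff_singleton {x : ι → ℕ} :
    x ∈ face (X \ {z}) ↔ x ∈ face X ∧ x z = 0 := by
  refine ⟨fun hx => ⟨fun i hi => hx i fun hi' => hi hi'.1, hx z fun hz => hz.2 rfl⟩, ?_⟩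
  rintro ⟨hx, hxz⟩ i hi
  obtain rfl | hiz := eq_or_ne i z
  exacts [hxz, hx i fun hiX => hi ⟨hiX, hiz⟩]

theorem indicator_compl_add_single [DecidableEq ι] (x : ι → ℕ) (z : ι) :
    Set.indicator {z}ᶜ x + Pi.single z (x z) = x := by
  ext i
  obtain rfl | hi := eq_or_ne i z <;> simp [*]

theorem IsPairOf.fiber [DecidableEq ι] (h : IsPairOf (face X) T S) (hz : z ∈ X)
    (hT : T ⊆ face (X \ {z})) (k : ℕ) :
    IsPairOf (face (X \ {z})) T {y | y ∈ face (X \ {z}) ∧ y + Pi.single z k ∈ S} := by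
  refine .of_exists_unique hT (fun y hy => hy.1)
    (fun t ht y hy => (face _).add_mem (hT ht) hy.1) ?_ ?_
  · intro x hx
    have hxk : x + Pi.single z k ∈ face X :=
      (face X).add_mem (mem_face_sdiff_singleton.1 hx).1 fun i hi =>
        Pi.single_eq_of_ne (M := fun _ => ℕ) (ne_of_mem_of_not_mem hz hi).symm k
    obtain ⟨t, ht, s, hs, hts⟩ := h.exists_add hxk
    have hsk : s z = k := by
      simpa [(mem_face_sdiff_singleton.1 (hT ht)).2, (mem_face_sdiff_singleton.1 hx).2]
        using congrFun hts z
    have hsum := indicator_compl_add_single s z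
    rw [hsk] at hsum
    have hface : Set.indicator {z}ᶜ s ∈ face (X \ {z}) :=
      mem_face_sdiff_singleton.2 ⟨indicator_mem_face (h.right_subset hs) _, by simp⟩
    refine ⟨t, ht, Set.indicator {z}ᶜ s, ⟨hface, by rwa [hsum]⟩, ?_⟩
    rwa [← hsum, ← add_assoc, add_left_inj] at hts
  · intro t ht t' ht' y hy y' hy' e
    have := h.eq_and_eq ht ht' hy.2 hy'.2 (by rw [← add_assoc, ← add_assoc, e])
    exact ⟨this.1, add_right_cancel this.2⟩

theorem IsPairOf.indicator_compl_mem_iff [Finite ι] (h : IsPairOf (face X) T S) (hz : z ∈ X)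
    (hT : T ⊆ face (X \ {z})) {x : ι → ℕ} (hx : x ∈ face X) :
    Set.indicator {z}ᶜ x ∈ S ↔ x ∈ S := by
  classical
  have hface : Set.indicator {z}ᶜ x ∈ face (X \ {z}) :=
    mem_face_sdiff_singleton.2 ⟨indicator_mem_face hx _, by simp⟩
  have hfiber := (h.fiber hz hT 0).right_unique (h.fiber hz hT (x z)) h.zero_mem_of_face
  simpa [hface, indicator_compl_add_single] using Set.ext_iff.1 hfiber (Set.indicator {z}ᶜ x)

theorem IsPrimitiveOn.exists_ne_zero [Finite ι] (h : IsPrimitiveOn X T S) (hX : X.Nontrivial)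
    (hz : z ∈ X) : ∃ t ∈ T, t z ≠ 0 := by
  by_contra! hTz
  have hT : T ⊆ face (X \ {z}) := fun t ht =>
    mem_face_sdiff_singleton.2 ⟨h.pair.left_subset ht, hTz t ht⟩
  obtain ⟨w, hw, hwz⟩ := hX.exists_ne z
  refine h.not_splits {z} ⟨z, hz, rfl⟩ ⟨w, hw, hwz⟩ ⟨?_, ?_⟩
  · have hzero : (fun _ => 0) ∈ T := h.pair.zero_mem_of_face
    have hsplits : SplitsAt ∅ T := fun x => by simp [hzero]
    exact hsplits.congr hT (by simp)
  · refine splitsAt_of_forall_mem_face h.pair.right_subset fun x hx => ?_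
    have hmem := h.pair.indicator_compl_mem_iff hz hT (indicator_mem_face hx {z})
    rw [Set.indicator_indicator, Set.compl_inter_self, Set.indicator_empty] at hmem
    rw [h.pair.indicator_compl_mem_iff hz hT hx]
    exact ⟨fun hxS => ⟨hmem.1 h.pair.symm.zero_mem_of_face, hxS⟩, And.right⟩

end Fiber

namespace RootedTree

variable {V : Type*} (Γ : RootedTree V) {U : Set V} {z : V}

/-- The tops of the subtree with node set `U`. -/
def topsIn (U : Set V) : Set V := {v | v ∈ U ∧ Disjoint (Γ.offspring v) U}

theorem topsIn_univ : Γ.topsIn Set.univ = {v | Γ.IsTop v} := by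
  simp [topsIn, IsTop]

theorem root_notMem_offspring (v : V) : Γ.root ∉ Γ.offspring v := fun h => by
  simpa [level] using h.2

theorem topsIn_root : Γ.topsIn {Γ.root} = {Γ.root} := by
  simp [topsIn, root_notMem_offspring]

theorem eq_of_mem_offspring {u v w : V} (hu : w ∈ Γ.offspring u) (hv : w ∈ Γ.offspring v) :
    u = v := by
  have exists_path {u : V} (hu : w ∈ Γ.offspring u) :
      ∃ p : Γ.graph.Path Γ.root w, p.1.penultimate = u := by
    obtain ⟨p, hp⟩ := Γ.isTree.1.exists_walk_length_eq_dist Γ.root u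
    refine ⟨⟨p.concat hu.1, SimpleGraph.Walk.isPath_of_length_eq_dist _ ?_⟩, by simp⟩
    rw [SimpleGraph.Walk.length_concat, hp]
    exact hu.2.symm
  obtain ⟨p, rfl⟩ := exists_path hu
  obtain ⟨q, rfl⟩ := exists_path hv
  rw [(Γ.isTree.2.subsingleton_path _ _).elim p q]

theorem notMem_offspring_self (v : V) : v ∉ Γ.offspring v := fun h => h.1.ne rfl

theorem mem_topsIn_sdiff_offspring (hz : z ∈ U) : z ∈ Γ.topsIn (U \ Γ.offspring z) :=
  ⟨⟨hz, Γ.notMem_offspring_self z⟩, Set.disjoint_sdiff_right⟩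

theorem topsIn_eq_sdiff_union_offspring (hz : ¬ Γ.IsTop z) (hzU : Γ.offspring z ⊆ U)
    (htops : Γ.offspring z ⊆ Γ.topsIn U) :
    Γ.topsIn U = Γ.topsIn (U \ Γ.offspring z) \ {z} ∪ Γ.offspring z := by
  obtain ⟨w, hw⟩ := Set.nonempty_iff_ne_empty.2 hz
  apply subset_antisymm
  · intro v hv
    by_cases hvz : v ∈ Γ.offspring z
    · exact .inr hvz
    · refine .inl ⟨⟨⟨hv.1, hvz⟩, hv.2.mono_right Set.sdiff_subset⟩, ?_⟩
      rintro rfl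
      exact Set.disjoint_left.1 hv.2 hw (hzU hw)
  · refine Set.union_subset ?_ htops
    rintro v ⟨⟨hvU, hv⟩, hvz⟩
    refine ⟨hvU.1, Set.disjoint_left.2 fun u hu huU => ?_⟩
    refine Set.disjoint_left.1 hv hu ⟨huU, fun huz => ?_⟩
    exact hvz (Γ.eq_of_mem_offspring hu huz)

end RootedTree

section Generated

variable {V : Type*} {Γ : RootedTree V} {W : Weight Γ} {U : Set V} {T S : Set (V → ℕ)}

theorem box_singleton [DecidableEq V] (r : V) (R : Set ℕ) :
    box {r} (fun _ => R) = AddMonoidHom.single (fun _ => ℕ) r '' R := by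
  ext y
  constructor
  · rintro ⟨hyr, hy⟩
    refine ⟨y r, hyr r rfl, funext fun v => ?_⟩
    obtain rfl | hv := eq_or_ne v r
    · simp
    · simp [hv, hy v hv]
  · rintro ⟨k, hk, rfl⟩
    exact ⟨by simpa, fun v hv => Pi.single_eq_of_ne (M := fun _ => ℕ) hv k⟩

theorem isPrimitiveOn_box_singleton (r : V) {T₀ S₀ : Set ℕ} (h : IsPairOf Set.univ T₀ S₀) :
    IsPrimitiveOn {r} (box {r} fun _ => T₀) (box {r} fun _ => S₀) := by
  classical
  refine ⟨?_, ?_⟩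
  · have hface : (face {r} : Set (V → ℕ)) = box {r} fun _ => Set.univ := by
      ext y
      simp [face, box]
    rw [hface, box_singleton, box_singleton, box_singleton]
    exact (isPairOf_image_iff (Pi.single_injective (M := fun _ => ℕ) r).injOn (Set.subset_univ _)
      (Set.subset_univ _) (Set.subset_univ _)).2 h
  · rintro s ⟨x, rfl, hx⟩ ⟨y, rfl, hy⟩ -
    exact hy hx

theorem exists_mem_box_singleton_ne_zero (r : V) {R : Set ℕ} (h0 : 0 ∈ R) (hR : R ≠ {0}) :
    ∃ y ∈ box {r} (fun _ => R), y r ≠ 0 := by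
  classical
  obtain ⟨k, hk, hk0⟩ : ∃ k ∈ R, k ≠ 0 := by
    by_contra! hc
    exact hR (Set.eq_singleton_iff_unique_mem.2 ⟨h0, hc⟩)
  exact ⟨Pi.single r k, (box_singleton r R).ge ⟨k, hk, rfl⟩, by simpa⟩

theorem Generates.eq_root_or_nontrivial_topsIn (hΓ : Γ.IsBranching) (h : Generates W U T S) :
    (U = {Γ.root} ∧ T = box {Γ.root} (fun _ => W.T₀) ∧ S = box {Γ.root} fun _ => W.S₀) ∨
      (Γ.topsIn U).Nontrivial := by
  cases h with
  | root => exact .inl ⟨rfl, rfl, rfl⟩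
  | branch _ z _ _ _ nonempty subset tops _ =>
    exact .inr ((hΓ z nonempty.ne_empty).mono fun x hx => ⟨subset hx, tops x hx⟩)

theorem Generates.exists_ne_zero [Finite V] (hΓ : Γ.IsBranching) (h : Generates W U T S)
    (hp : IsPrimitiveOn (Γ.topsIn U) T S) {z : V} (hzU : z ∈ Γ.topsIn U) (hz : ¬ Γ.IsTop z) :
    (W.δ z = 0 → ∃ t ∈ T, t z ≠ 0) ∧ (W.δ z = 1 → ∃ s ∈ S, s z ≠ 0) := by
  obtain ⟨rfl, rfl, rfl⟩ | hU := h.eq_root_or_nontrivial_topsIn hΓ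
  · obtain rfl : z = Γ.root := hzU.1
    have hzero := Set.mem_univ (0 : ℕ)
    constructor
    · intro hδ
      refine exists_mem_box_singleton_ne_zero _ (W.initial.zero_mem hzero) fun hT => ?_
      exact zero_ne_one (hδ.symm.trans (W.δ_root_of_left hz hT))
    · intro hδ
      refine exists_mem_box_singleton_ne_zero _ (W.initial.symm.zero_mem hzero) fun hS => ?_
      exact zero_ne_one ((W.δ_root_of_right hz hS).symm.trans hδ)
  · exact ⟨fun _ => hp.exists_ne_zero hU hzU, fun _ => hp.symm.exists_ne_zero hU hzU⟩

theorem Generates.isPrimitiveOn [Finite V] (hΓ : Γ.IsBranching) (h : Generates W U T S) :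
    IsPrimitiveOn (Γ.topsIn U) T S := by
  induction h with
  | root => exact Γ.topsIn_root.symm ▸ isPrimitiveOn_box_singleton _ W.initial
  | branch U z T S mem nonempty subset tops hgen ih =>
    have hz : ¬ Γ.IsTop z := nonempty.ne_empty
    have hzU := Γ.mem_topsIn_sdiff_offspring mem
    have hroot (v : V) (hv : v ∈ Γ.offspring z) : v ≠ Γ.root :=
      ne_of_mem_of_not_mem hv (Γ.root_notMem_offspring z)
    have hdisj : Γ.offspring z ∩ Γ.topsIn (U \ Γ.offspring z) ⊆ {z} :=
      fun v hv => absurd hv.1 hv.2.1.2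
    obtain ⟨hT, hS⟩ := hgen.exists_ne_zero hΓ ih hzU hz
    rw [Γ.topsIn_eq_sdiff_union_offspring hz subset fun x hx => ⟨subset hx, tops x hx⟩]
    exact ih.extend hzU nonempty hdisj (fun v hv => W.α_pos v (hroot v hv))
      (fun v hv => W.interval v (hroot v hv)) hT hS

end Generated

/-! ### Primitive pairs are extensions -/

section Corner

variable {ι : Type*} {B : Set ι} {a b : ι → ℕ} {T S : Set (ι → ℕ)}

/-- The vector `a`, supported exactly on `B`, belongs to `S` while the corner `L_a` lies in `T`.
This is the local pattern that identifies a second type extension. -/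
structure HasCorner (B : Set ι) (a : ι → ℕ) (T S : Set (ι → ℕ)) : Prop where
  nonempty : B.Nonempty
  pos : ∀ i ∈ B, 0 < a i
  mem_face : a ∈ face B
  corner_subset : corner B a ⊆ T
  mem : a ∈ S

/-- On the translate `b + L_a` of the corner, `T` is everything or nothing, and `S` contains at
most the vertex `b`. -/
structure IsRegularAt (B : Set ι) (a : ι → ℕ) (T S : Set (ι → ℕ)) (b : ι → ℕ) : Prop where
  add_mem_iff : ∀ l ∈ corner B a, b + l ∈ T ↔ b ∈ T
  eq_zero : ∀ l ∈ corner B a, b + l ∈ S → l = 0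

theorem HasCorner.zero_mem (hc : HasCorner B a T S) : 0 ∈ corner B a :=
  zero_mem_corner hc.nonempty hc.pos

theorem HasCorner.mem_base (hc : HasCorner B a T S) : a ∈ base B a :=
  hc.nonempty.elim fun _ _ => ⟨1, fun _ _ => (one_mul _).symm⟩

theorem HasCorner.tsub_lt (hc : HasCorner B a T S) {m : ι → ℕ} (hm : m ∈ corner B a)
    (hm0 : m ≠ 0) : m - a < m := by
  refine lt_of_le_of_ne tsub_le_self fun e => hm0 (funext fun i => ?_)
  by_cases hi : i ∈ B
  · have h : m i - a i = m i := congrFun e i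
    have := hc.pos i hi
    rw [Pi.zero_apply]
    omega
  · exact hm.1 i hi

theorem HasCorner.tsub_mem_corner (hc : HasCorner B a T S) {m : ι → ℕ} (hm : m ∈ corner B a)
    (hm0 : m ≠ 0) : a - m ∈ corner B a := by
  refine ⟨mem_face_of_le hc.mem_face tsub_le_self, fun h => hm0 (funext fun i => ?_)⟩
  by_cases hi : i ∈ B
  · have h : a i ≤ a i - m i := h i hi
    have := hc.pos i hi
    rw [Pi.zero_apply]
    omega
  · exact hm.1 i hi

theorem tsub_mem_base {b b' : ι → ℕ} (hb : b ∈ base B a) (hb' : b' ∈ base B a) :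
    b - b' ∈ base B a := by
  obtain ⟨k, hk⟩ := hb
  obtain ⟨k', hk'⟩ := hb'
  exact ⟨k - k', fun i hi => by rw [Pi.sub_apply, hk i hi, hk' i hi, Nat.sub_mul]⟩

theorem HasCorner.isRegularAt_of_mem_right (hc : HasCorner B a T S) (h : IsNPair T S)
    (hb : b ∈ S) : IsRegularAt B a T S b := by
  have hS0 : 0 ∈ S := h.symm.zero_mem trivial
  refine ⟨fun l hl => ?_, fun l hl hs => ?_⟩
  · obtain rfl | hb0 := eq_or_ne b 0
    · simp only [zero_add, hc.corner_subset hl, hc.corner_subset hc.zero_mem]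
    · refine iff_of_false (fun hT => hb0 ?_) fun hT =>
        hb0 (h.eq_zero (h.zero_mem trivial) hS0 hT hb)
      exact (h.eq_and_eq (hc.corner_subset hl) hT hb hS0 (by rw [add_zero, add_comm])).2
  · exact (h.eq_and_eq (hc.corner_subset hc.zero_mem) (hc.corner_subset hl) hs hb
      (by rw [zero_add, add_comm])).1.symm

theorem HasCorner.mem_base_or_exists_eq_add (hc : HasCorner B a T S) (hb : b ∈ base B a)
    (ih : ∀ b' < b, b' ∈ base B a → IsRegularAt B a T S b') {s l : ι → ℕ} (hs : s ∈ S)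
    (hl : l ∈ corner B a) (hle : s ≤ b + l) :
    (s ∈ base B a ∧ s < b) ∨ ∃ m ∈ corner B a, s = b + m := by
  obtain ⟨b', hb', l', hl', rfl⟩ := exists_base_add_corner hc.nonempty hc.pos s
  obtain hlt | rfl := (le_of_base_add_corner_le hb hb' hl hl' hle).lt_or_eq
  · obtain rfl := (ih b' hlt hb').eq_zero l' hl' hs
    rw [add_zero]
    exact .inl ⟨hb', hlt⟩
  · exact .inr ⟨l', hl', rfl⟩

theorem HasCorner.add_mem_left (hc : HasCorner B a T S) (h : IsNPair T S) (hb : b ∈ base B a)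
    (ih : ∀ b' < b, b' ∈ base B a → IsRegularAt B a T S b') (hbT : b ∈ T) {l : ι → ℕ}
    (hl : l ∈ corner B a) (hm : ∀ m ∈ corner B a, m ≤ l → b + m ∉ S) : b + l ∈ T := by
  obtain ⟨t, ht, s, hs, e⟩ := h.exists_add (Set.mem_univ (b + l))
  have hsle : s ≤ b + l := e ▸ le_add_self
  obtain ⟨hsB, hsb⟩ | ⟨m, hmc, rfl⟩ := hc.mem_base_or_exists_eq_add hb ih hs hl hsle
  · obtain rfl | hs0 := eq_or_ne s 0
    · rwa [← e, add_zero]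
    have hbs : b - s + s = b := tsub_add_cancel_of_le hsb.le
    have hlt : b - s < b := lt_of_le_of_ne tsub_le_self fun hc => hs0 (by simpa [hc] using hbs)
    have ht' : t = b - s + l := add_right_cancel (b := s) (by rw [e, add_right_comm, hbs])
    have hbsT : b - s ∈ T := ((ih _ hlt (tsub_mem_base hb hsB)).add_mem_iff l hl).1 (ht' ▸ ht)
    exact absurd (h.eq_and_eq hbsT hbT hs (h.symm.zero_mem trivial) (by rw [hbs, add_zero])).2 hs0
  · exact absurd hs (hm m hmc ((add_le_add_iff_left b).1 hsle))

theorem HasCorner.add_notMem_right [Finite ι] (hc : HasCorner B a T S) (h : IsNPair T S)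
    (hb : b ∈ base B a) (ih : ∀ b' < b, b' ∈ base B a → IsRegularAt B a T S b') (hbT : b ∈ T)
    (hbS : b ∉ S) {m : ι → ℕ} (hm : m ∈ corner B a) : b + m ∉ S := by
  induction m using WellFoundedLT.induction with
  | ind m ihm =>
    intro hs
    have hm0 : m ≠ 0 := by
      rintro rfl
      exact hbS (by rwa [add_zero] at hs)
    have hlt := hc.tsub_lt hm hm0
    have hx : b + (m - a) ∈ T := hc.add_mem_left h hb ih hbT (mem_corner_of_le hm hlt.le)
      fun m' hmem hle => ihm m' (hle.trans_lt hlt) hmem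
    -- Both sides equal `b + max m a`; the left one uses `a ∈ S` and the right one `b + m ∈ S`.
    have e : b + (m - a) + a = (a - m) + (b + m) := by
      ext i
      simp only [Pi.add_apply, Pi.sub_apply]
      omega
    have hab := (h.eq_and_eq hx (hc.corner_subset (hc.tsub_mem_corner hm hm0)) hc.mem hs e).2
    exact hm0 (eq_and_eq_of_base_add_corner_eq hc.mem_base hb hc.zero_mem hm
      (by rw [add_zero, hab])).2.symm

theorem HasCorner.isRegularAt_of_notMem (hc : HasCorner B a T S) (h : IsNPair T S)
    (hb : b ∈ base B a) (ih : ∀ b' < b, b' ∈ base B a → IsRegularAt B a T S b') (hbT : b ∉ T)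
    (hbS : b ∉ S) : IsRegularAt B a T S b := by
  obtain ⟨t, ht, s, hs, rfl⟩ := h.exists_add (Set.mem_univ b)
  have hS0 : 0 ∈ S := h.symm.zero_mem trivial
  have hs0 : s ≠ 0 := by
    rintro rfl
    exact hbT (by rwa [add_zero])
  have hsB : s ∈ base B a := by
    obtain ⟨hsB, -⟩ | ⟨m, -, e⟩ := hc.mem_base_or_exists_eq_add hb ih hs hc.zero_mem
      (le_add_self.trans le_self_add)
    · exact hsB
    · have hle : t + s + m ≤ s := e.ge
      have : s = t + s := le_antisymm le_add_self (le_self_add.trans hle)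
      exact absurd (this ▸ hs) hbS
  have hlt : t < t + s := lt_add_of_pos_right t (pos_iff_ne_zero.2 hs0)
  have htB : t ∈ base B a := by simpa using tsub_mem_base hb hsB
  have hfib {l : ι → ℕ} (hl : l ∈ corner B a) : t + l ∈ T :=
    ((ih t hlt htB).add_mem_iff l hl).2 ht
  refine ⟨fun l hl => iff_of_false (fun hT => hs0 ?_) hbT, fun l hl hS => ?_⟩
  · exact (h.eq_and_eq (hfib hl) hT hs hS0 (by rw [add_zero, add_right_comm])).2
  · have e := (h.eq_and_eq (hfib hl) (hc.corner_subset hc.zero_mem) hs hS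
      (by rw [zero_add, add_right_comm])).1
    exact (add_eq_zero.1 e).2

theorem HasCorner.isRegularAt [Finite ι] (hc : HasCorner B a T S) (h : IsNPair T S)
    (hb : b ∈ base B a) : IsRegularAt B a T S b := by
  induction b using WellFoundedLT.induction with
  | ind b ih =>
    by_cases hbS : b ∈ S
    · exact hc.isRegularAt_of_mem_right h hbS
    by_cases hbT : b ∈ T
    · have hS {m : ι → ℕ} (hm : m ∈ corner B a) := hc.add_notMem_right h hb ih hbT hbS hm
      exact ⟨fun l hl => iff_of_true (hc.add_mem_left h hb ih hbT hl fun m hm _ => hS hm) hbT,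
        fun l hl hs => absurd hs (hS hl)⟩
    · exact hc.isRegularAt_of_notMem h hb ih hbT hbS

/-- The pair obtained by undoing a second type extension along `B`, in the variables `Bᶜ` and a
variable `z ∈ B` that stands for the product of the variables in `B`. -/
noncomputable def contract (z : ι) (B : Set ι) (a : ι → ℕ) (T : Set (ι → ℕ)) : Set (ι → ℕ) :=
  face (insert z Bᶜ) ∩ substituteHom z B a ⁻¹' T

theorem contract_subset_face {z : ι} : contract z B a T ⊆ face (insert z Bᶜ) :=
  Set.inter_subset_left

theorem inter_insert_compl_subset {z : ι} : B ∩ insert z Bᶜ ⊆ {z} :=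
  fun _ hv => hv.2.resolve_right (not_not_intro hv.1)

theorem insert_compl_diff_union {z : ι} (hz : z ∈ B) : insert z Bᶜ \ {z} ∪ B = Set.univ := by
  ext v
  by_cases hv : v ∈ B
  · simp [hv]
  · simp [hv, (ne_of_mem_of_not_mem hz hv).symm]

theorem image_contract {z : ι} (hz : z ∈ B) :
    substituteHom z B a '' contract z B a T = (base B a : Set (ι → ℕ)) ∩ T := by
  rw [contract, Set.image_inter_preimage,
    substituteHom_image_face (Set.mem_insert z _) inter_insert_compl_subset,
    insert_compl_diff_union hz, AddSubmonoid.coe_inf, coe_face_univ, Set.univ_inter]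

theorem HasCorner.left_eq [Finite ι] (hc : HasCorner B a T S) (h : IsNPair T S) {z : ι}
    (hz : z ∈ B) : T = substituteHom z B a '' contract z B a T + corner B a := by
  rw [image_contract hz]
  ext x
  constructor
  · intro hx
    obtain ⟨b, hb, l, hl, rfl⟩ := exists_base_add_corner hc.nonempty hc.pos x
    exact ⟨b, ⟨hb, ((hc.isRegularAt h hb).add_mem_iff l hl).1 hx⟩, l, hl, rfl⟩
  · rintro ⟨b, ⟨hb, hbT⟩, l, hl, rfl⟩
    exact ((hc.isRegularAt h hb).add_mem_iff l hl).2 hbT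

theorem HasCorner.right_eq [Finite ι] (hc : HasCorner B a T S) (h : IsNPair T S) {z : ι}
    (hz : z ∈ B) : S = substituteHom z B a '' contract z B a S := by
  rw [image_contract hz]
  refine Set.Subset.antisymm (fun x hx => ⟨?_, hx⟩) Set.inter_subset_right
  obtain ⟨b, hb, l, hl, rfl⟩ := exists_base_add_corner hc.nonempty hc.pos x
  rw [(hc.isRegularAt h hb).eq_zero l hl hx, add_zero]
  exact hb

end Corner

section FirstReduction

variable {ι : Type*} {B : Set ι} {N N' : ι → ℕ} {C D : ι → Set ℕ} {T S T' S' T'' S'' : Set (ι → ℕ)}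

/-- `(T, S)` is obtained from `(T', S')` by first type extensions of sizes `N` along all the
variables; a variable of size `1` is left unchanged. -/
def IsFirstExtension (N : ι → ℕ) (T' S' T S : Set (ι → ℕ)) : Prop :=
  ∃ C D : ι → Set ℕ, (∀ i, IsIntervalPair (N i) (C i) (D i)) ∧
    T = firstExtend N C T' ∧ S = firstExtend N D S'

theorem IsFirstExtension.symm (h : IsFirstExtension N T' S' T S) :
    IsFirstExtension N S' T' S T := by
  obtain ⟨C, D, hC, hT, hS⟩ := h
  exact ⟨D, C, fun i => (hC i).symm, hS, hT⟩

theorem isFirstExtension_one : IsFirstExtension 1 T S T S :=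
  ⟨_, _, fun _ => isIntervalPair_one, firstExtend_one.symm, firstExtend_one.symm⟩

theorem IsFirstExtension.trans (h : IsFirstExtension N T' S' T S)
    (h' : IsFirstExtension N' T'' S'' T' S') : IsFirstExtension (N * N') T'' S'' T S := by
  obtain ⟨C, D, hC, rfl, rfl⟩ := h
  obtain ⟨C', D', hC', rfl, rfl⟩ := h'
  exact ⟨_, _, fun i => (hC i).mul (hC' i), firstExtend_firstExtend, firstExtend_firstExtend⟩

theorem IsFirstExtension.size_pos (h : IsFirstExtension N T' S' T S) (i : ι) : 0 < N i := by
  obtain ⟨_, _, hC, -⟩ := h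
  exact (hC i).one_le_size

theorem IsFirstExtension.isNPair (h : IsFirstExtension N T' S' T S) (hTS : IsNPair T S) :
    IsNPair T' S' := by
  obtain ⟨C, D, hC, rfl, rfl⟩ := h
  have hX : ∀ i ∉ Set.univ, N i = 1 := fun i hi => absurd (Set.mem_univ i) hi
  have hsub (R : Set (ι → ℕ)) : R ⊆ face (Set.univ : Set ι) := by
    rw [coe_face_univ]
    exact Set.subset_univ R
  rw [IsNPair, ← coe_face_univ] at hTS ⊢
  exact (isPairOf_firstExtend_iff hC hX (hsub T') (hsub S')).1 hTS

theorem mem_firstExtend_iff_of_lt (hC : ∀ i, IsIntervalPair (N i) (C i) (D i)) (h0 : 0 ∈ T)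
    {x : ι → ℕ} {i : ι} (hlt : x i < N i) : x ∈ firstExtend N C T ↔
      Set.indicator {i} x ∈ firstExtend N C T ∧ Set.indicator {i}ᶜ x ∈ firstExtend N C T := by
  have hself : Set.indicator {i} x / N = 0 := by
    ext j
    obtain rfl | hj := eq_or_ne j i
    · simp [Nat.div_eq_of_lt hlt]
    · simp [hj]
  have hcompl : Set.indicator {i}ᶜ x / N = x / N := by
    ext j
    obtain rfl | hj := eq_or_ne j i
    · simp [Nat.div_eq_of_lt hlt]
    · simp [hj]
  have hmod : (∀ j, x j % N j ∈ C j) ↔ (∀ j, Set.indicator {i} x j % N j ∈ C j) ∧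
      ∀ j, Set.indicator {i}ᶜ x j % N j ∈ C j := by
    rw [← forall_and]
    refine forall_congr' fun j => ?_
    obtain rfl | hj := eq_or_ne j i <;> simp [*, (hC _).zero_mem]
  simp only [firstExtend, Set.mem_ofPred_eq, hself, hcompl, hmod, h0, and_true, and_assoc]

theorem IsNPair.exists_size_le (h : IsNPair T S) {i : ι}
    (hi : ¬ (SplitsAt {i} T ∧ SplitsAt {i} S)) :
    ∃ M, ∀ N T' S', IsFirstExtension N T' S' T S → N i ≤ M := by
  contrapose! hi
  have key {T S : Set (ι → ℕ)} (h : IsNPair T S)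
      (hi : ∀ M, ∃ N T' S', IsFirstExtension N T' S' T S ∧ M < N i) : SplitsAt {i} T := by
    intro x
    obtain ⟨N, T', S', hext, hlt⟩ := hi (x i)
    have h0 : 0 ∈ T' := (hext.isNPair h).zero_mem trivial
    obtain ⟨C, D, hC, rfl, -⟩ := hext
    exact mem_firstExtend_iff_of_lt hC h0 hlt
  refine ⟨key h hi, key h.symm fun M => ?_⟩
  obtain ⟨N, T', S', hext, hlt⟩ := hi M
  exact ⟨N, S', T', hext.symm, hlt⟩

theorem IsNPair.mem_of_forall_le (h : IsNPair T S) {x : ι → ℕ} (hx : ∀ s ∈ S, s ≤ x → s = 0) :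
    x ∈ T := by
  obtain ⟨t, ht, s, hs, rfl⟩ := h.exists_add (Set.mem_univ x)
  rwa [hx s hs le_add_self, add_zero]

theorem IsNPair.eq_of_tsub_mem (h : IsNPair T S) {s s' : ι → ℕ} (hs : s ∈ S) (hs' : s' ∈ S)
    (ht : s - s' ∈ T) (ht' : s' - s ∈ T) : s = s' :=
  (h.eq_and_eq ht' ht hs hs' (funext fun i => by simp only [Pi.add_apply, Pi.sub_apply]; omega)).2

variable [DecidableEq ι]

theorem eq_single_of_le_single {x : ι → ℕ} {i : ι} {k : ℕ} (h : x ≤ Pi.single i k) :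
    x = Pi.single i (x i) :=
  funext fun j => by
    obtain rfl | hj := eq_or_ne j i
    · rw [Pi.single_eq_same]
    · simpa [hj] using h j

theorem IsNPair.isPairOf_axis (h : IsNPair T S) (i : ι) :
    IsPairOf Set.univ {k | Pi.single i k ∈ T} {k | Pi.single i k ∈ S} := by
  refine IsPairOf.preimage (φ := AddMonoidHom.single (fun _ => ℕ) i) h
    (Pi.single_injective (M := fun _ => ℕ) i) ?_
  rintro x y ⟨k, hk⟩
  exact ⟨⟨x i, (eq_single_of_le_single (le_self_add.trans hk.ge)).symm⟩,
    ⟨y i, (eq_single_of_le_single (le_add_self.trans hk.ge)).symm⟩⟩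

theorem IsNPair.exists_single_mem_right (h : IsNPair T S) {i : ι} {k : ℕ}
    (hk : Pi.single i k ∉ T) : ∃ m, 0 < m ∧ Pi.single i m ∈ S := by
  contrapose! hk
  refine h.mem_of_forall_le fun s hs hle => ?_
  have hsi := eq_single_of_le_single hle
  rw [hsi] at hs ⊢
  rw [Nat.eq_zero_of_not_pos fun hpos => hk _ hpos hs, Pi.single_zero]

theorem IsNPair.exists_hasCorner_singleton (h : IsNPair T S) {i : ι} (h1 : Pi.single i 1 ∈ T)
    {k : ℕ} (hk : Pi.single i k ∉ T) :
    ∃ m, 1 < m ∧ HasCorner {i} (Pi.single i m) T S := by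
  classical
  have hex := h.exists_single_mem_right hk
  have hm := Nat.find_spec hex
  have hmin {m : ℕ} (hlt : m < Nat.find hex) : ¬ (0 < m ∧ Pi.single i m ∈ S) := Nat.find_min hex hlt
  set m := Nat.find hex
  have hm1 : m ≠ 1 := fun e => by
    simpa using congrFun (h.eq_zero (h.zero_mem trivial) (h.symm.zero_mem trivial) h1 (e ▸ hm.2)) i
  refine ⟨m, by omega, Set.singleton_nonempty i, ?_, fun j hj => ?_, ?_, hm.2⟩
  · rintro j rfl
    rw [Pi.single_eq_same]
    exact hm.1
  · exact Pi.single_eq_of_ne (M := fun _ => ℕ) hj m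
  · rintro l ⟨hl, hlm⟩
    have hli : l i < m := by simpa using hlm
    refine h.mem_of_forall_le fun s hs hle => ?_
    have hsi : s = Pi.single i (s i) := eq_single_of_le_single (k := l i) fun j => by
      obtain rfl | hj := eq_or_ne j i
      · simpa using hle j
      · simpa [hj, hl j hj] using hle j
    rw [hsi] at hs ⊢
    rw [Nat.eq_zero_of_not_pos fun hpos => hmin ((hle i).trans_lt hli) ⟨hpos, hs⟩, Pi.single_zero]

theorem mulSingle_mul_mem_base (i : ι) (m : ℕ) (y : ι → ℕ) :
    Pi.mulSingle i m * y ∈ base {i} (Pi.single i m) :=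
  ⟨y i, by simp [mul_comm]⟩

theorem mod_mulSingle_mem_corner (i : ι) {m : ℕ} (hm : 0 < m) (x : ι → ℕ) :
    (fun j => x j % (Pi.mulSingle i m : ι → ℕ) j) ∈ corner {i} (Pi.single i m) := by
  refine ⟨fun j hj => ?_, fun hle => (Nat.mod_lt (x i) hm).not_ge (by simpa using hle i rfl)⟩
  simp only [Pi.mulSingle_eq_of_ne (M := fun _ => ℕ) hj m, Nat.mod_one]

theorem HasCorner.isFirstExtension [Finite ι] (h : IsNPair T S) {i : ι} {m : ℕ}
    (hc : HasCorner {i} (Pi.single i m) T S) :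
    IsFirstExtension (Pi.mulSingle i m) {y | Pi.mulSingle i m * y ∈ T}
      {y | Pi.mulSingle i m * y ∈ S} T S := by
  have hm : 0 < m := by simpa using hc.pos i rfl
  have hcorner := mod_mulSingle_mem_corner i hm
  have hreg (y : ι → ℕ) := hc.isRegularAt h (mulSingle_mul_mem_base i m y)
  set N : ι → ℕ := Pi.mulSingle i m
  have hNpos (j : ι) : 0 < N j := by
    obtain rfl | hj := eq_or_ne j i <;> simp [N, *]
  have hx (x : ι → ℕ) : N * (x / N) + (fun j => x j % N j) = x :=
    funext fun j => Nat.div_add_mod (x j) (N j)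
  have hx0 {x : ι → ℕ} (h0 : (fun j => x j % N j) = 0) : N * (x / N) = x := by
    simpa only [h0, add_zero] using hx x
  refine ⟨fun j => Set.Iio (N j), fun _ => {0}, fun j => isIntervalPair_Iio (hNpos j), ?_, ?_⟩
  · ext x
    have hmod (j : ι) : x j % N j ∈ Set.Iio (N j) := Nat.mod_lt _ (hNpos j)
    have hT := (hreg (x / N)).add_mem_iff _ (hcorner x)
    rw [hx] at hT
    exact hT.trans (and_iff_right hmod).symm
  · ext x
    constructor
    · intro hxS
      have h0 := (hreg (x / N)).eq_zero _ (hcorner x) (by rwa [hx])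
      exact ⟨congrFun h0, show N * (x / N) ∈ S by rwa [hx0 h0]⟩
    · rintro ⟨h0, hxS⟩
      exact hx0 (funext h0) ▸ hxS

theorem IsNPair.exists_isFirstExtension_of_axis [Finite ι] (h : IsNPair T S) {i : ι} {k k' : ℕ}
    (hk : Pi.single i k ∉ T) (hk' : Pi.single i k' ∉ S) :
    ∃ N T' S', IsFirstExtension N T' S' T S ∧ 1 < N i ∧ ∀ j ≠ i, N j = 1 := by
  obtain ⟨t, ht, s, hs, e⟩ := (h.isPairOf_axis i).exists_add (Set.mem_univ 1)
  obtain rfl | rfl : t = 1 ∨ s = 1 := by omega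
  · obtain ⟨m, hm, hc⟩ := h.exists_hasCorner_singleton ht hk
    exact ⟨_, _, _, hc.isFirstExtension h, by rwa [Pi.mulSingle_eq_same],
      fun j hj => Pi.mulSingle_eq_of_ne (M := fun _ => ℕ) hj m⟩
  · obtain ⟨m, hm, hc⟩ := h.symm.exists_hasCorner_singleton hs hk'
    exact ⟨_, _, _, (hc.isFirstExtension h.symm).symm, by rwa [Pi.mulSingle_eq_same],
      fun j hj => Pi.mulSingle_eq_of_ne (M := fun _ => ℕ) hj m⟩

theorem IsNPair.exists_isFirstExtension_of_pure_axes [Finite ι] (h : IsNPair T S) (B : Set ι)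
    (hB : ∀ i ∈ B, ¬ (SplitsAt {i} T ∧ SplitsAt {i} S)) :
    ∃ N T' S', IsFirstExtension N T' S' T S ∧ (∀ i ∉ B, N i = 1) ∧
      ∀ i ∈ B, (∀ k, Pi.single i k ∈ T') ∨ ∀ k, Pi.single i k ∈ S' := by
  have := Fintype.ofFinite ι
  let K : Set (ι → ℕ) := {N | (∀ i ∉ B, N i = 1) ∧ ∃ T' S', IsFirstExtension N T' S' T S}
  have hK : K.Finite := by
    have hbdd (i : ι) : ∃ M, ∀ N ∈ K, N i ≤ M := by
      by_cases hi : i ∈ B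
      · obtain ⟨M, hM⟩ := h.exists_size_le (hB i hi)
        exact ⟨M, fun N ⟨_, T', S', hext⟩ => hM N T' S' hext⟩
      · exact ⟨1, fun N hN => (hN.1 i hi).le⟩
    choose M hM using hbdd
    exact (Set.finite_Iic M).subset fun N hN i => hM i N hN
  obtain ⟨N, ⟨hN, T', S', hext⟩, hmax⟩ :=
    hK.exists_maximal ⟨1, fun _ _ => rfl, T, S, isFirstExtension_one⟩
  refine ⟨N, T', S', hext, hN, fun i hi => ?_⟩
  by_contra! hpure
  obtain ⟨⟨k, hk⟩, k', hk'⟩ := hpure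
  obtain ⟨N', T'', S'', hext', hi1, hN'⟩ :=
    (hext.isNPair h).exists_isFirstExtension_of_axis hk hk'
  have hmem : N * N' ∈ K := by
    refine ⟨fun j hj => ?_, T'', S'', hext.trans hext'⟩
    rw [Pi.mul_apply, hN j hj, hN' j (ne_of_mem_of_not_mem hi hj).symm]
  have hle := hmax hmem (fun j => Nat.le_mul_of_pos_right _ (hext'.size_pos j)) i
  exact (lt_mul_right (hext.size_pos i) hi1).not_ge hle

end FirstReduction

section AxisProduct

variable {ι : Type*} {B P Q : Set ι} {N a : ι → ℕ} {C D : ι → Set ℕ}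
  {T S T' S' : Set (ι → ℕ)}

/-- If `T` contains the boundary of the face of `B` but not the whole face, then the least nonzero
point of `S` in this face is the vertex of a corner. -/
theorem IsNPair.exists_hasCorner_of_boundary_subset [Finite ι] (h : IsNPair T S)
    (hface : ¬ (face B : Set (ι → ℕ)) ⊆ T)
    (hboundary : ∀ x ∈ face B, (∃ i ∈ B, x i = 0) → x ∈ T) : ∃ a, HasCorner B a T S := by
  have hS0 : 0 ∈ S := h.symm.zero_mem trivial
  have hne : {s : ι → ℕ | s ∈ S ∧ s ∈ face B ∧ s ≠ 0}.Nonempty := by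
    by_contra! hempty
    refine hface fun x hx => h.mem_of_forall_le fun s hs hle => by_contra fun hs0 => ?_
    exact Set.eq_empty_iff_forall_notMem.1 hempty s ⟨hs, mem_face_of_le hx hle, hs0⟩
  obtain ⟨a, ⟨haS, haB, ha0⟩, hmin⟩ := wellFounded_lt.has_min _ hne
  have hB : B.Nonempty := by
    by_contra! hB
    exact ha0 (funext fun i => haB i (hB ▸ Set.notMem_empty i))
  have tsub_mem {u v : ι → ℕ} (hu : u ∈ face B) (hv : v ∈ face B) (huv : ¬ u ≤ v) :
      v - u ∈ T := by
    obtain ⟨i, hi⟩ := not_forall.1 (mt Pi.le_def.2 huv)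
    refine hboundary _ (mem_face_of_le hv tsub_le_self) ⟨i, by_contra fun hiB => hi ?_, ?_⟩
    · exact (hu i hiB).trans_le (Nat.zero_le _)
    · exact Nat.sub_eq_zero_of_le (le_of_not_ge hi)
  refine ⟨a, hB, fun i hi => ?_, haB, fun l hl => ?_, haS⟩
  · refine Nat.pos_of_ne_zero fun hai => ha0 ?_
    exact h.eq_zero (h.zero_mem trivial) hS0 (hboundary a haB ⟨i, hi, hai⟩) haS
  · refine h.mem_of_forall_le fun s hs hle => by_contra fun hs0 => ?_
    have hsB : s ∈ face B := mem_face_of_le hl.1 hle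
    have has : ¬ a ≤ s := fun hc => hl.2 fun i _ => (hc i).trans (hle i)
    have hsa : ¬ s ≤ a := fun hc => hmin s ⟨hs, hsB, hs0⟩ (lt_of_le_not_ge hc has)
    exact hsa (h.eq_of_tsub_mem hs haS (tsub_mem haB hsB has) (tsub_mem hsB haB hsa)).le

theorem IsPrimitiveNPair.not_splitsAt_singleton [Nontrivial ι] (h : IsPrimitiveNPair T S) (i : ι) :
    ¬ (SplitsAt {i} T ∧ SplitsAt {i} S) := fun hi => by
  obtain ⟨j, hj⟩ := exists_ne i
  exact h.2 (h.1.isCartesianProduct_iff.2 ⟨{i}, ⟨i, rfl⟩, ⟨j, hj⟩, hi⟩)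

variable [DecidableEq ι]

/-- On the face of the variables in `B`, the set `T` is the product of its intersections with the
coordinate axes. -/
def IsAxisProduct (B : Set ι) (T : Set (ι → ℕ)) : Prop :=
  ∀ x ∈ face B, x ∈ T ↔ ∀ i, Pi.single i (x i) ∈ T

theorem isAxisProduct_of_subsingleton (hB : B.Subsingleton) (h0 : 0 ∈ T) : IsAxisProduct B T := by
  intro x hx
  obtain rfl | ⟨i, rfl⟩ := hB.eq_empty_or_singleton
  · obtain rfl : x = 0 := funext fun i => hx i (Set.notMem_empty i)
    simp only [Pi.zero_apply, Pi.single_zero, h0, implies_true]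
  · have hxi : Pi.single i (x i) = x :=
      funext fun j => by
        obtain rfl | hj := eq_or_ne j i
        · rw [Pi.single_eq_same]
        · rw [Pi.single_eq_of_ne hj, hx j hj]
    refine ⟨fun hxT j => ?_, fun h => hxi ▸ h i⟩
    obtain rfl | hj := eq_or_ne j i
    · rwa [hxi]
    · rwa [hx j hj, Pi.single_zero]

theorem IsAxisProduct.splitsAt_singleton (h : IsAxisProduct Set.univ T) (h0 : 0 ∈ T) (i : ι) :
    SplitsAt {i} T := by
  have hmem (x : ι → ℕ) : x ∈ T ↔ ∀ j, Pi.single j (x j) ∈ T :=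
    h x fun j hj => absurd (Set.mem_univ j) hj
  intro x
  rw [hmem x, hmem (Set.indicator {i} x), hmem (Set.indicator {i}ᶜ x), ← forall_and]
  refine forall_congr' fun j => ?_
  obtain rfl | hj := eq_or_ne j i
  · simpa using fun _ => h0
  · simpa [hj] using fun _ => h0

theorem IsAxisProduct.face_subset (h : IsAxisProduct B T) (h0 : 0 ∈ T)
    (hB : ∀ i ∈ B, ∀ k, Pi.single i k ∈ T) : (face B : Set (ι → ℕ)) ⊆ T := by
  refine fun x hx => (h x hx).2 fun i => ?_
  by_cases hi : i ∈ B
  · exact hB i hi _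
  · rwa [hx i hi, Pi.single_zero]

theorem single_mem_firstExtend_iff (hC : ∀ i, IsIntervalPair (N i) (C i) (D i)) {i : ι} {k : ℕ} :
    Pi.single i k ∈ firstExtend N C T ↔ k % N i ∈ C i ∧ Pi.single i (k / N i) ∈ T := by
  have hdiv : (Pi.single i k : ι → ℕ) / N = Pi.single i (k / N i) := by
    ext j
    obtain rfl | hj := eq_or_ne j i <;> simp [*]
  rw [firstExtend, Set.mem_ofPred_eq, hdiv]
  refine and_congr_left fun _ => ⟨fun h => by simpa using h i, fun h j => ?_⟩
  obtain rfl | hj := eq_or_ne j i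
  · simpa using h
  · simpa [hj] using (hC j).zero_mem

theorem isAxisProduct_firstExtend_iff (hC : ∀ i, IsIntervalPair (N i) (C i) (D i)) :
    IsAxisProduct B (firstExtend N C T) ↔ IsAxisProduct B T := by
  refine ⟨fun h y hy => ?_, fun h x hx => ?_⟩
  · have hNy : N * y ∈ face B := fun i hi => by rw [Pi.mul_apply, hy i hi, mul_zero]
    have hsingle (i : ι) : Pi.single i ((N * y) i) = N * Pi.single i (y i) := by
      ext j
      obtain rfl | hj := eq_or_ne j i <;> simp [*]
    have := h (N * y) hNy
    simpa only [hsingle, mul_mem_firstExtend_iff hC] using this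
  · have hxN : x / N ∈ face B := fun i hi => by rw [Pi.div_apply, hx i hi, Nat.zero_div]
    simp only [single_mem_firstExtend_iff hC, forall_and]
    exact and_congr_right fun _ => h (x / N) hxN

theorem IsFirstExtension.isAxisProduct_iff (h : IsFirstExtension N T' S' T S) :
    IsAxisProduct B T ∧ IsAxisProduct B S ↔ IsAxisProduct B T' ∧ IsAxisProduct B S' := by
  obtain ⟨C, D, hC, rfl, rfl⟩ := h
  exact and_congr (isAxisProduct_firstExtend_iff hC)
    (isAxisProduct_firstExtend_iff fun i => (hC i).symm)

theorem single_apply_le (x : ι → ℕ) (i : ι) : Pi.single i (x i) ≤ x := fun j => by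
  obtain rfl | hj := eq_or_ne j i <;> simp [*]

theorem IsNPair.isAxisProduct_union (h : IsNPair T S) (hP : (face P : Set (ι → ℕ)) ⊆ T)
    (hQ : (face Q : Set (ι → ℕ)) ⊆ S) : IsAxisProduct (P ∪ Q) T := by
  have hmem {x : ι → ℕ} (hx : x ∈ face (P ∪ Q)) : x ∈ T ↔ x ∈ face P := by
    have hxP : P.indicator x ∈ face P := fun i hi => Set.indicator_of_notMem hi x
    have hxQ : Pᶜ.indicator x ∈ face Q := fun i hi => by
      by_cases hiP : i ∈ P
      · exact Set.indicator_of_notMem (Set.notMem_compl_iff.2 hiP) x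
      · rw [Set.indicator_of_mem (Set.mem_compl hiP), hx i fun hc => hc.elim hiP hi]
    refine ⟨fun hxT => ?_, fun hx => hP hx⟩
    have := (h.eq_and_eq (hP hxP) hxT (hQ hxQ) (h.symm.zero_mem trivial)
      (by rw [Set.indicator_self_add_compl, add_zero])).1
    exact this ▸ hxP
  intro x hx
  have hsingle (i : ι) : Pi.single i (x i) ∈ face (P ∪ Q) :=
    mem_face_of_le hx (single_apply_le x i)
  rw [hmem hx, forall_congr' fun i => hmem (hsingle i)]
  refine ⟨fun hxP i => mem_face_of_le hxP (single_apply_le x i), fun hall i hi => ?_⟩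
  simpa using hall i i hi

theorem IsNPair.exists_hasCorner_of_axes_subset [Finite ι] (h : IsNPair T S)
    (hB : ¬ (IsAxisProduct B T ∧ IsAxisProduct B S))
    (hmin : ∀ B' ⊂ B, IsAxisProduct B' T) (hT : ∀ i ∈ B, ∀ k, Pi.single i k ∈ T) :
    ∃ a, HasCorner B a T S := by
  refine h.exists_hasCorner_of_boundary_subset (fun hface => hB ?_) fun x hx ⟨j, hj, hxj⟩ => ?_
  · have hempty : (face (∅ : Set ι) : Set (ι → ℕ)) ⊆ S := fun x hx => by
      obtain rfl : x = 0 := funext fun i => hx i (Set.notMem_empty i)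
      exact h.symm.zero_mem trivial
    have hBT := h.isAxisProduct_union hface hempty
    have hBS := h.symm.isAxisProduct_union hempty hface
    rw [Set.union_empty] at hBT
    rw [Set.empty_union] at hBS
    exact ⟨hBT, hBS⟩
  · refine (hmin (B \ {j}) (Set.sdiff_singleton_ssubset.2 hj)).face_subset (h.zero_mem trivial)
      (fun i hi => hT i hi.1) fun i hi => ?_
    obtain rfl | hij := eq_or_ne i j
    · exact hxj
    · exact hx i fun hiB => hi ⟨hiB, hij⟩

theorem IsNPair.exists_hasCorner [Finite ι] (h : IsNPair T S)
    (hB : ¬ (IsAxisProduct B T ∧ IsAxisProduct B S))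
    (hmin : ∀ B' ⊂ B, IsAxisProduct B' T ∧ IsAxisProduct B' S)
    (hpure : ∀ i ∈ B, (∀ k, Pi.single i k ∈ T) ∨ ∀ k, Pi.single i k ∈ S) :
    ∃ a, HasCorner B a T S ∨ HasCorner B a S T := by
  let P : Set ι := {i ∈ B | ∀ k, Pi.single i k ∈ T}
  let Q : Set ι := {i ∈ B | ∀ k, Pi.single i k ∈ S}
  have hPQ : P ∪ Q = B := by
    rw [← Set.sep_or]
    exact Set.sep_eq_self_iff_mem_true.2 hpure
  have hPB : P ⊆ B := Set.sep_subset _ _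
  have hQB : Q ⊆ B := Set.sep_subset _ _
  obtain hP | hP := hPB.eq_or_ssubset
  · obtain ⟨a, ha⟩ := h.exists_hasCorner_of_axes_subset hB (fun B' hB' => (hmin B' hB').1)
      fun i hi => (hP.ge hi).2
    exact ⟨a, .inl ha⟩
  obtain hQ | hQ := hQB.eq_or_ssubset
  · obtain ⟨a, ha⟩ := h.symm.exists_hasCorner_of_axes_subset (mt And.symm hB)
      (fun B' hB' => (hmin B' hB').2) fun i hi => (hQ.ge hi).2
    exact ⟨a, .inr ha⟩
  have hPT := (hmin P hP).1.face_subset (h.zero_mem trivial) fun i hi => hi.2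
  have hQS := (hmin Q hQ).2.face_subset (h.symm.zero_mem trivial) fun i hi => hi.2
  have hBT := h.isAxisProduct_union hPT hQS
  have hBS := h.symm.isAxisProduct_union hQS hPT
  rw [hPQ] at hBT
  rw [Set.union_comm, hPQ] at hBS
  exact absurd ⟨hBT, hBS⟩ hB

theorem IsPrimitiveNPair.exists_minimal_not_isAxisProduct [Finite ι] [Nontrivial ι]
    (h : IsPrimitiveNPair T S) :
    ∃ B : Set ι, B.Nontrivial ∧ ¬ (IsAxisProduct B T ∧ IsAxisProduct B S) ∧
      ∀ B' ⊂ B, IsAxisProduct B' T ∧ IsAxisProduct B' S := by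
  have hT0 : 0 ∈ T := h.1.zero_mem trivial
  have hS0 : 0 ∈ S := h.1.symm.zero_mem trivial
  obtain ⟨i⟩ := (inferInstance : Nonempty ι)
  obtain ⟨B, hB, hmin⟩ := wellFounded_lt.has_min
    {B : Set ι | ¬ (IsAxisProduct B T ∧ IsAxisProduct B S)} ⟨Set.univ, fun hc =>
      h.not_splitsAt_singleton i
        ⟨hc.1.splitsAt_singleton hT0 i, hc.2.splitsAt_singleton hS0 i⟩⟩
  refine ⟨B, ?_, hB, fun B' hB' => not_not.1 fun hc => hmin B' hc hB'⟩
  by_contra hnt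
  have hsub := Set.not_nontrivial_iff.1 hnt
  exact hB ⟨isAxisProduct_of_subsingleton hsub hT0, isAxisProduct_of_subsingleton hsub hS0⟩

end AxisProduct

section Existence

variable {ι : Type*} [Finite ι] {B : Set ι} {z : ι} {a : ι → ℕ} {T S : Set (ι → ℕ)}

theorem HasCorner.exists_substituteHom_add (hc : HasCorner B a T S)
    (h : IsPrimitiveOn Set.univ T S) (hz : z ∈ B) :
    ∃ T' S', IsPrimitiveOn (insert z Bᶜ) T' S' ∧ S' ≠ {0} ∧
      T = substituteHom z B a '' T' + cornerOrZero B a 1 ∧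
      S = substituteHom z B a '' S' + cornerOrZero B a 0 := by
  have hpair : IsNPair T S := (isPrimitiveOn_univ_iff.1 h).1
  have hT : T = substituteHom z B a '' contract z B a T + cornerOrZero B a 1 := by
    rw [cornerOrZero_one, ← hc.left_eq hpair hz]
  have hS : S = substituteHom z B a '' contract z B a S + cornerOrZero B a (1 - 1) := by
    rw [sub_self, cornerOrZero_zero, Set.add_singleton, ← hc.right_eq hpair hz]
    simp only [add_zero, Set.image_id']
  refine ⟨_, _, .of_substituteHom_add (Set.mem_insert z _) hc.nonempty hc.pos
    inter_insert_compl_subset contract_subset_face contract_subset_face (ε := 1) ?_,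
    fun h0 => (hc.pos z hz).ne' ?_, hT, by rwa [sub_self] at hS⟩
  · rwa [insert_compl_diff_union hz, ← hT, ← hS]
  · have haS := hc.mem
    rw [hc.right_eq hpair hz, h0, Set.image_singleton, map_zero] at haS
    exact congrFun haS z

theorem IsPrimitiveNPair.exists_extend [Nontrivial ι] (h : IsPrimitiveNPair T S) :
    ∃ (B : Set ι) (z : ι) (C D : ι → Set ℕ) (a N : ι → ℕ) (ε : Fin 2) (T' S' : Set (ι → ℕ)),
      B.Nontrivial ∧ z ∈ B ∧ (∀ i ∈ B, 0 < a i) ∧ (∀ i, IsIntervalPair (N i) (C i) (D i)) ∧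
      IsPrimitiveOn (insert z Bᶜ) T' S' ∧ (T' = {0} → ε = 1) ∧ (S' = {0} → ε = 0) ∧
      T = extend z B C a N ε T' ∧ S = extend z B D a N (1 - ε) S' := by
  classical
  obtain ⟨B, hnt, hB, hmin⟩ := h.exists_minimal_not_isAxisProduct
  obtain ⟨z, hz⟩ := hnt.nonempty
  obtain ⟨N, T₁, S₁, hext, hN, hpure⟩ :=
    h.1.exists_isFirstExtension_of_pure_axes B fun i _ => h.not_splitsAt_singleton i
  obtain ⟨a, hc⟩ := (hext.isNPair h.1).exists_hasCorner (mt hext.isAxisProduct_iff.2 hB)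
    (fun B' hB' => hext.isAxisProduct_iff.1 (hmin B' hB')) hpure
  obtain ⟨C, D, hC, rfl, rfl⟩ := hext
  have hprim : IsPrimitiveOn Set.univ T₁ S₁ := by
    rw [← isPrimitiveOn_univ_iff] at h
    have hsub (R : Set (ι → ℕ)) : R ⊆ face (Set.univ : Set ι) := by
      rw [coe_face_univ]
      exact Set.subset_univ R
    exact (isPrimitiveOn_firstExtend_iff hC (fun i hi => absurd (Set.mem_univ i) hi) (hsub _)
      (hsub _)).1 h
  have hD i := (hC i).symm
  obtain hc | hc := hc
  · obtain ⟨T', S', h', hS', rfl, rfl⟩ := hc.exists_substituteHom_add hprim hz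
    refine ⟨B, z, C, D, a, N, 1, T', S', hnt, hz, hc.pos, hC, h', fun _ => rfl, (absurd · hS'), ?_,
      ?_⟩
    · rw [extend_eq_firstExtend hC hN]
    · rw [extend_eq_firstExtend hD hN, sub_self]
  · obtain ⟨S', T', h', hT', rfl, rfl⟩ := hc.exists_substituteHom_add hprim.symm hz
    refine ⟨B, z, C, D, a, N, 0, T', S', hnt, hz, hc.pos, hC, h'.symm, (absurd · hT'), fun _ => rfl,
      ?_, ?_⟩
    · rw [extend_eq_firstExtend hC hN]
    · rw [extend_eq_firstExtend hD hN, sub_zero]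

end Existence

/-! ### Grafting trees -/

/-- A rooted tree given by the parents and the depths of its nodes; the parent of the root is
irrelevant. -/
structure ParentTree (V : Type*) where
  root : V
  parent : V → V
  depth : V → ℕ
  depth_root : depth root = 0
  depth_eq : ∀ v, v ≠ root → depth v = depth (parent v) + 1

namespace ParentTree

variable {V : Type*} (P : ParentTree V)

/-- The graph underlying a tree given by parents: every node other than the root is joined to its
parent. -/
def graph : SimpleGraph V where
  Adj u v := (v ≠ P.root ∧ P.parent v = u) ∨ (u ≠ P.root ∧ P.parent u = v)
  symm := ⟨fun _ _ h => h.symm⟩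
  loopless := ⟨by
    rintro v (⟨hv, hpv⟩ | ⟨hv, hpv⟩) <;>
    · have := P.depth_eq v hv
      rw [hpv] at this
      omega⟩

theorem adj_parent {v : V} (hv : v ≠ P.root) : P.graph.Adj (P.parent v) v := .inl ⟨hv, rfl⟩

theorem exists_walk_length_eq_depth (v : V) :
    ∃ p : P.graph.Walk P.root v, p.length = P.depth v := by
  induction hd : P.depth v generalizing v with
  | zero =>
    obtain rfl | hv := eq_or_ne v P.root
    · exact ⟨.nil, rfl⟩
    · exact absurd (P.depth_eq v hv) (by omega)
  | succ d ih =>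
    have hv : v ≠ P.root := by
      rintro rfl
      exact absurd P.depth_root (by omega)
    obtain ⟨p, hp⟩ := ih (P.parent v) (by have := P.depth_eq v hv; omega)
    exact ⟨p.concat (P.adj_parent hv), by rw [SimpleGraph.Walk.length_concat, hp]⟩

theorem depth_le_add_length {u v : V} (p : P.graph.Walk u v) :
    P.depth v ≤ P.depth u + p.length := by
  induction p with
  | nil => exact Nat.le_add_right _ _
  | cons h p ih =>
    rw [SimpleGraph.Walk.length_cons]
    obtain ⟨hne, rfl⟩ | ⟨hne, rfl⟩ := h <;>
    · have := P.depth_eq _ hne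
      omega

theorem connected : P.graph.Connected := by
  have hroot (v : V) : P.graph.Reachable P.root v :=
    let ⟨p, _⟩ := P.exists_walk_length_eq_depth v
    ⟨p⟩
  have : Nonempty V := ⟨P.root⟩
  exact ⟨fun u v => (hroot u).symm.trans (hroot v)⟩

theorem dist_root (v : V) : P.graph.dist P.root v = P.depth v := by
  refine le_antisymm ?_ ?_
  · obtain ⟨p, hp⟩ := P.exists_walk_length_eq_depth v
    exact hp ▸ SimpleGraph.dist_le p
  · obtain ⟨p, hp⟩ := P.connected.exists_walk_length_eq_dist P.root v
    simpa only [P.depth_root, zero_add, hp] using P.depth_le_add_length p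

theorem bijective_parentEdge : Function.Bijective fun v : {v // v ≠ P.root} =>
    (⟨s(P.parent v, v), P.adj_parent v.2⟩ : P.graph.edgeSet) := by
  constructor
  · rintro ⟨v, hv⟩ ⟨w, hw⟩ hvw
    obtain ⟨_, heq⟩ | ⟨hpv, hpw⟩ := Sym2.eq_iff.1 (congrArg Subtype.val hvw)
    · exact Subtype.ext heq
    · have hdv := P.depth_eq v hv
      have hdw := P.depth_eq w hw
      rw [hpv] at hdv
      rw [← hpw] at hdw
      dsimp only at hdv hdw
      omega
  · rintro ⟨e, he⟩
    induction e with
    | h u v =>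
      obtain ⟨hv, hpv⟩ | ⟨hu, hpu⟩ := he
      · exact ⟨⟨v, hv⟩, Subtype.ext (congrArg (s(·, v)) hpv)⟩
      · exact ⟨⟨u, hu⟩, Subtype.ext ((congrArg (s(·, u)) hpu).trans Sym2.eq_swap)⟩

theorem isTree [Finite V] : P.graph.IsTree := by
  classical
  have := Fintype.ofFinite V
  have : 0 < Fintype.card V := Fintype.card_pos_iff.2 ⟨P.root⟩
  rw [SimpleGraph.isTree_iff_connected_and_card,
    ← Nat.card_congr (Equiv.ofBijective _ P.bijective_parentEdge), Nat.card_eq_fintype_card,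
    Nat.card_eq_fintype_card, Fintype.card_subtype_compl, Fintype.card_subtype_eq]
  exact ⟨P.connected, by omega⟩

/-- The rooted tree with the given parents. -/
def toRootedTree [Finite V] : RootedTree V := ⟨P.graph, P.isTree, P.root⟩

theorem mem_offspring [Finite V] {u v : V} :
    v ∈ P.toRootedTree.offspring u ↔ v ≠ P.root ∧ P.parent v = u := by
  change P.graph.Adj u v ∧ P.graph.dist P.root v = P.graph.dist P.root u + 1 ↔ _
  rw [dist_root, dist_root]
  constructor
  · rintro ⟨hv | ⟨hu, rfl⟩, hd⟩
    · exact hv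
    · exact absurd (P.depth_eq u hu) (by omega)
  · rintro ⟨hv, rfl⟩
    exact ⟨P.adj_parent hv, P.depth_eq v hv⟩

end ParentTree

section Transfer

variable {κ V V' : Type*} {f : V' → V}

theorem extendZero_extendZero (hf : Function.Injective f) {g : κ → V'} (hg : Function.Injective g)
    (y : κ → ℕ) : extendZero f (extendZero g y) = extendZero (f ∘ g) y := by
  ext v
  by_cases hv : v ∈ Set.range f
  · obtain ⟨w, rfl⟩ := hv
    rw [extendZero_apply hf]
    by_cases hw : w ∈ Set.range g
    · obtain ⟨k, rfl⟩ := hw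
      rw [extendZero_apply hg]
      exact (extendZero_apply (hf.comp hg) y k).symm
    · rw [extendZero_notMem y hw, extendZero_notMem y]
      rintro ⟨k, hk⟩
      exact hw ⟨k, hf hk⟩
  · rw [extendZero_notMem _ hv]
    exact (extendZero_notMem y fun ⟨k, hk⟩ => hv ⟨g k, hk⟩).symm

theorem extendZero_id (y : V → ℕ) : extendZero id y = y :=
  funext (extendZero_apply Function.injective_id y)

theorem image_extendZero_preimage (hf : Function.Injective f) {T : Set (V → ℕ)}
    (hT : T ⊆ face (Set.range f)) : extendZero f '' (extendZero f ⁻¹' T) = T :=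
  Set.image_preimage_eq_of_subset (by rwa [range_extendZero hf])

theorem extendZero_mem_face_image (hf : Function.Injective f) {B : Set V'} {y : V' → ℕ} :
    extendZero f y ∈ face (f '' B) ↔ y ∈ face B := by
  refine ⟨fun h v hv => ?_, fun h v hv => ?_⟩
  · rw [← extendZero_apply hf y v]
    exact h _ (mt hf.mem_set_image.1 hv)
  · by_cases hr : v ∈ Set.range f
    · obtain ⟨v, rfl⟩ := hr
      rw [extendZero_apply hf]
      exact h v fun hvB => hv (Set.mem_image_of_mem f hvB)
    · exact extendZero_notMem y hr

theorem face_image_subset (B : Set V') : (face (f '' B) : Set (V → ℕ)) ⊆ face (Set.range f) :=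
  fun _ hx v hv => hx v fun h => hv (Set.image_subset_range f B h)

theorem image_extendZero_box (hf : Function.Injective f) (B : Set V') (C : V → Set ℕ) :
    extendZero f '' box B (C ∘ f) = box (f '' B) C := by
  rw [← image_extendZero_preimage (T := box (f '' B) C) hf fun y hy => face_image_subset B hy.2]
  congr 1
  ext y
  refine and_congr ?_ (extendZero_mem_face_image hf).symm
  simp only [Set.forall_mem_image, extendZero_apply hf, Function.comp_apply]

theorem image_extendZero_corner (hf : Function.Injective f) (B : Set V') (a : V → ℕ) :
    extendZero f '' corner B (a ∘ f) = corner (f '' B) a := by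
  rw [← image_extendZero_preimage (T := corner (f '' B) a) hf fun y hy => face_image_subset B hy.1]
  congr 1
  ext y
  refine and_congr (extendZero_mem_face_image hf).symm (not_congr ?_)
  simp only [Set.forall_mem_image, extendZero_apply hf, Function.comp_apply]

theorem extendZero_mul (hf : Function.Injective f) (N : V → ℕ) (y : V' → ℕ) :
    extendZero f ((N ∘ f) * y) = N * extendZero f y := by
  ext v
  by_cases hv : v ∈ Set.range f
  · obtain ⟨v, rfl⟩ := hv
    simp only [extendZero_apply hf, Pi.mul_apply, Function.comp_apply]
  · rw [Pi.mul_apply, extendZero_notMem _ hv, extendZero_notMem _ hv, mul_zero]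

theorem image_extendZero_cornerPow (hf : Function.Injective f) (B : Set V') (a N : V → ℕ)
    (ε : Fin 2) : extendZero f '' cornerPow B (a ∘ f) (N ∘ f) ε = cornerPow (f '' B) a N ε := by
  unfold cornerPow
  split_ifs
  · rw [← image_extendZero_corner hf, Set.image_image, Set.image_image]
    exact Set.image_congr fun y _ => extendZero_mul hf N y
  · rw [Set.image_singleton, map_zero]

/-- The variable substituted in the image of `h` need not be the image under `f` of the one
substituted in the image of `k`. For `h = f` and `k = id` this is the naturality of `substitute`;
otherwise, `h` and `k` extend the same vectors over an old tree and over the set of new tops. -/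
theorem extendZero_substitute (hf : Function.Injective f) {h : κ → V} {k : κ → V'}
    (hh : Function.Injective h) (hk : Function.Injective k) {x₀ : κ}
    (hhk : ∀ x ≠ x₀, h x = f (k x)) (hx₀ : ∀ v, f v = h x₀ → v = k x₀) (B : Set V') (b : V → ℕ)
    (t : κ → ℕ) : substitute (h x₀) (f '' B) b (extendZero h t) =
      extendZero f (substitute (k x₀) B (b ∘ f) (extendZero k t)) := by
  ext v
  by_cases hv : v ∈ Set.range f
  · obtain ⟨v, rfl⟩ := hv
    have hmem : f v ∈ f '' B ↔ v ∈ B := hf.mem_set_image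
    rw [extendZero_apply hf]
    by_cases hvB : v ∈ B
    · simp only [substitute, hvB, hmem.2 hvB, if_true, extendZero_apply hh, extendZero_apply hk,
        Function.comp_apply]
    simp only [substitute, hvB, mt hmem.1 hvB, if_false]
    split_ifs with hvh hvk hvk
    · rfl
    · exact absurd (hx₀ v hvh) hvk
    · refine extendZero_notMem t fun ⟨x, hx⟩ => hvh (hx ▸ congrArg h (by_contra fun hne => hne ?_))
      exact hk (hf (hhk x hne ▸ hx) |>.trans hvk)
    · by_cases hr : v ∈ Set.range k
      · obtain ⟨x, rfl⟩ := hr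
        rw [extendZero_apply hk, ← hhk x (ne_of_apply_ne k hvk), extendZero_apply hh]
      · rw [extendZero_notMem t hr]
        refine extendZero_notMem t fun ⟨x, hx⟩ => hr ⟨x, hf ?_⟩
        exact hhk x (ne_of_apply_ne h (hx ▸ hvh)) ▸ hx
  · rw [extendZero_notMem _ hv, substitute, if_neg fun hvB => hv (Set.image_subset_range f B hvB)]
    split_ifs with hvh
    · rfl
    · refine extendZero_notMem t fun ⟨x, hx⟩ => hv ⟨k x, ?_⟩
      rw [← hhk x (ne_of_apply_ne h (hx ▸ hvh)), hx]

theorem extend_image_extendZero (hf : Function.Injective f) {h : κ → V} {k : κ → V'}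
    (hh : Function.Injective h) (hk : Function.Injective k) {x₀ : κ}
    (hhk : ∀ x ≠ x₀, h x = f (k x)) (hx₀ : ∀ v, f v = h x₀ → v = k x₀) (B : Set V')
    (C : V → Set ℕ) (a N : V → ℕ) (ε : Fin 2) (R : Set (κ → ℕ)) :
    extend (h x₀) (f '' B) C a N ε (extendZero h '' R) =
      extendZero f '' extend (k x₀) B (C ∘ f) (a ∘ f) (N ∘ f) ε (extendZero k '' R) := by
  unfold extend
  rw [Set.image_add, Set.image_add, image_extendZero_box hf, image_extendZero_cornerPow hf]
  simp only [Set.image_image]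
  congr 1
  exact Set.image_congr fun t _ => extendZero_substitute hf hh hk hhk hx₀ B (fun v => a v * N v) t

theorem Generates.map {Γ' : RootedTree V'} {Γ : RootedTree V} {W' : Weight Γ'} {W : Weight Γ}
    (hf : Function.Injective f) (hroot : f Γ'.root = Γ.root)
    (hoff : ∀ v, ¬ Γ'.IsTop v → Γ.offspring (f v) = f '' Γ'.offspring v)
    (htop : ∀ v, Γ'.IsTop v → Disjoint (Γ.offspring (f v)) (Set.range f))
    (hT : W.T₀ = W'.T₀) (hS : W.S₀ = W'.S₀) (hδ : ∀ v, ¬ Γ'.IsTop v → W.δ (f v) = W'.δ v)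
    (hα : W.α ∘ f = W'.α) (hC : W.C ∘ f = W'.C) (hD : W.D ∘ f = W'.D)
    (hsize : W.size ∘ f = W'.size) {U : Set V'} {T S : Set (V' → ℕ)} (h : Generates W' U T S) :
    Generates W (f '' U) (extendZero f '' T) (extendZero f '' S) := by
  have hextend (z : V') (B : Set V') (C : V → Set ℕ) (ε : Fin 2) (R : Set (V' → ℕ)) :
      extendZero f '' extend z B (C ∘ f) W'.α W'.size ε R =
        extend (f z) (f '' B) C W.α W.size ε (extendZero f '' R) := by
    rw [extend_image_extendZero hf hf Function.injective_id (fun _ _ => rfl) fun v hv => hf hv]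
    simp only [extendZero_id, Set.image_id', hα, hsize, id_eq]
  induction h with
  | root =>
    have := Generates.root (W := W)
    rw [← hroot, ← Set.image_singleton, ← image_extendZero_box hf, ← image_extendZero_box hf, hT,
      hS] at this
    exact this
  | branch U z T S mem nonempty subset tops _ ih =>
    have hz : ¬ Γ'.IsTop z := nonempty.ne_empty
    rw [← hC, ← hD, hextend, hextend, ← hδ z hz, ← hoff z hz]
    refine .branch (f '' U) (f z) _ _ (Set.mem_image_of_mem f mem) ?_ ?_ ?_ ?_ <;> rw [hoff z hz]
    · exact nonempty.image f
    · exact Set.image_mono subset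
    · rintro _ ⟨x, hx, rfl⟩
      by_cases hxt : Γ'.IsTop x
      · exact (htop x hxt).mono_right (Set.image_subset_range f U)
      · rw [hoff x hxt, Set.disjoint_image_iff hf]
        exact tops x hx
    · rwa [← Set.image_sdiff hf]

end Transfer

theorem Generates.eq_of_isTop_root {V : Type*} {Γ : RootedTree V} {W : Weight Γ} {U : Set V}
    {T S : Set (V → ℕ)} (h : Generates W U T S) (hroot : Γ.IsTop Γ.root) :
    U = {Γ.root} ∧ T = box {Γ.root} (fun _ => W.T₀) ∧ S = box {Γ.root} fun _ => W.S₀ := by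
  induction h with
  | root => exact ⟨rfl, rfl, rfl⟩
  | branch U z T S mem nonempty _ _ _ ih =>
    have hz : z ∈ U \ Γ.offspring z := ⟨mem, Γ.notMem_offspring_self z⟩
    rw [ih.1] at hz
    exact absurd (hz ▸ hroot) nonempty.ne_empty

section Graft

variable {V β : Type*} [Finite V] [Finite β] {z : V}

namespace ParentTree

/-- The tree obtained by adding the nodes of `β` as offsprings of the node `z`. -/
def graft {V : Type*} (P : ParentTree V) (z : V) (β : Type*) : ParentTree (V ⊕ β) where
  root := .inl P.root
  parent := Sum.elim (fun v => .inl (P.parent v)) fun _ => .inl z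
  depth := Sum.elim P.depth fun _ => P.depth z + 1
  depth_root := P.depth_root
  depth_eq := by
    rintro (v | b) hv
    · exact P.depth_eq v fun h => hv (congrArg Sum.inl h)
    · rfl

variable (P : ParentTree V)

theorem offspring_graft_inl_of_ne {v : V} (hv : v ≠ z) :
    (P.graft z β).toRootedTree.offspring (.inl v) = Sum.inl '' P.toRootedTree.offspring v := by
  ext (w | b) <;> simp [mem_offspring, graft, hv.symm]

theorem offspring_graft_inl_self (hz : P.toRootedTree.IsTop z) :
    (P.graft z β).toRootedTree.offspring (.inl z) = Set.range Sum.inr := by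
  have hz' (w : V) : w ∉ P.toRootedTree.offspring z := Set.eq_empty_iff_forall_notMem.1 hz w
  simp only [mem_offspring] at hz'
  ext (w | b)
  · simpa [mem_offspring, graft] using hz' w
  · simp [mem_offspring, graft]

theorem isTop_graft_inr (b : β) : (P.graft z β).toRootedTree.IsTop (.inr b) := by
  refine Set.eq_empty_iff_forall_notMem.2 ?_
  rintro (v | b') <;> simp [mem_offspring, graft]

theorem isTop_graft_inl_iff [Nonempty β] (hz : P.toRootedTree.IsTop z) {v : V} :
    (P.graft z β).toRootedTree.IsTop (.inl v) ↔ P.toRootedTree.IsTop v ∧ v ≠ z := by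
  obtain rfl | hv := eq_or_ne v z
  · simp [RootedTree.IsTop, P.offspring_graft_inl_self hz]
  · simp [RootedTree.IsTop, P.offspring_graft_inl_of_ne hv, hv]

theorem setOf_isTop_graft [Nonempty β] (hz : P.toRootedTree.IsTop z) :
    {v | (P.graft z β).toRootedTree.IsTop v} =
      Sum.inl '' ({v | P.toRootedTree.IsTop v} \ {z}) ∪ Set.range Sum.inr := by
  ext (v | b)
  · simp [P.isTop_graft_inl_iff hz]
  · simp [P.isTop_graft_inr b]

theorem isBranching_graft [Nontrivial β] (hz : P.toRootedTree.IsTop z)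
    (hP : P.toRootedTree.IsBranching) : (P.graft z β).toRootedTree.IsBranching := by
  rintro (v | b) hv
  · obtain rfl | hvz := eq_or_ne v z
    · rw [P.offspring_graft_inl_self hz]
      exact Set.image_univ ▸ Set.nontrivial_univ.image Sum.inr_injective
    · rw [P.offspring_graft_inl_of_ne hvz]
      exact (hP v fun h => hv ((P.isTop_graft_inl_iff hz).2 ⟨h, hvz⟩)).image Sum.inl_injective
  · exact absurd (P.isTop_graft_inr b) hv

end ParentTree

open Classical in
/-- The weight of the grafted tree that extends `W`. -/
noncomputable def Weight.graft {P : ParentTree V} (W : Weight P.toRootedTree) (z : V)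
    (C D : β → Set ℕ) (a N : β → ℕ) (ε : Fin 2) (ha : ∀ b, 0 < a b)
    (hC : ∀ b, IsIntervalPair (N b) (C b) (D b))
    (hroot : P.toRootedTree.IsTop P.root → P.root = z)
    (hT : P.root = z → W.T₀ = {0} → ε = 1) (hS : P.root = z → W.S₀ = {0} → ε = 0) :
    Weight (P.graft z β).toRootedTree where
  T₀ := W.T₀
  S₀ := W.S₀
  initial := W.initial
  δ := Sum.elim (fun v => if v = z then ε else W.δ v) fun _ => 0
  α := Sum.elim W.α a
  C := Sum.elim W.C C
  D := Sum.elim W.D D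
  size := Sum.elim W.size N
  α_pos := by
    rintro (v | b) hv
    · exact W.α_pos v fun h => hv (congrArg Sum.inl h)
    · exact ha b
  interval := by
    rintro (v | b) hv
    · exact W.interval v fun h => hv (congrArg Sum.inl h)
    · exact hC b
  δ_root_of_left _ h := by
    change (if P.root = z then ε else W.δ P.root) = 1
    split_ifs with hz
    · exact hT hz h
    · exact W.δ_root_of_left (mt hroot hz) h
  δ_root_of_right _ h := by
    change (if P.root = z then ε else W.δ P.root) = 0
    split_ifs with hz
    · exact hS hz h
    · exact W.δ_root_of_right (mt hroot hz) h

theorem Generates.graft [Nonempty β] {P : ParentTree V} {W : Weight P.toRootedTree}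
    {C D : β → Set ℕ} {a N : β → ℕ} {ε : Fin 2} {ha : ∀ b, 0 < a b}
    {hC : ∀ b, IsIntervalPair (N b) (C b) (D b)}
    {hroot : P.toRootedTree.IsTop P.root → P.root = z}
    {hT : P.root = z → W.T₀ = {0} → ε = 1} {hS : P.root = z → W.S₀ = {0} → ε = 0}
    {T S : Set (V → ℕ)} (h : Generates W Set.univ T S) (hz : P.toRootedTree.IsTop z) :
    Generates (W.graft z C D a N ε ha hC hroot hT hS) Set.univ
      (extend (.inl z) (Set.range .inr) (Sum.elim W.C C) (Sum.elim W.α a) (Sum.elim W.size N) ε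
        (extendZero Sum.inl '' T))
      (extend (.inl z) (Set.range .inr) (Sum.elim W.D D) (Sum.elim W.α a) (Sum.elim W.size N)
        (1 - ε) (extendZero Sum.inl '' S)) := by
  have hoff := P.offspring_graft_inl_self (β := β) hz
  have hne {v : V} (hv : ¬ P.toRootedTree.IsTop v) : v ≠ z := fun hvz => hv (hvz ▸ hz)
  let W' := W.graft z C D a N ε ha hC hroot hT hS
  have hδ : W'.δ (.inl z) = ε := if_pos rfl
  have hold : Generates W' (Set.univ \ Set.range Sum.inr) (extendZero Sum.inl '' T)
      (extendZero Sum.inl '' S) := by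
    have huniv : (Set.univ : Set (V ⊕ β)) \ Set.range Sum.inr = Sum.inl '' Set.univ := by
      ext (v | b) <;> simp
    rw [huniv]
    refine h.map Sum.inl_injective rfl (fun v hv => P.offspring_graft_inl_of_ne (hne hv))
      (fun v hv => ?_) rfl rfl (fun v hv => if_neg (hne hv)) rfl rfl rfl rfl
    obtain rfl | hvz := eq_or_ne v z
    · rw [hoff]
      exact Set.isCompl_range_inl_range_inr.symm.disjoint
    · have hv' : P.toRootedTree.offspring v = ∅ := hv
      rw [P.offspring_graft_inl_of_ne hvz, hv', Set.image_empty]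
      exact Set.empty_disjoint _
  have hbranch := Generates.branch (W := W') Set.univ (.inl z) (extendZero Sum.inl '' T)
    (extendZero Sum.inl '' S) (Set.mem_univ _) (hoff ▸ Set.range_nonempty _) (Set.subset_univ _)
    (fun x hx => ?_) (hoff ▸ hold)
  · rwa [hoff, hδ] at hbranch
  · obtain ⟨b, rfl⟩ := hoff ▸ hx
    have htop : (P.graft z β).toRootedTree.offspring (.inr b) = ∅ := P.isTop_graft_inr b
    rw [htop]
    exact Set.empty_disjoint _

end Graft

section Realizable

universe u

variable {ι : Type u} {T S : Set (ι → ℕ)}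

/-- The pair `(T, S)` is generated by a weighted tree whose tops are indexed by `ι`. -/
def IsRealizable (T S : Set (ι → ℕ)) : Prop :=
  ∃ (V : Type u) (_ : Finite V) (P : ParentTree V) (W : Weight P.toRootedTree) (g : ι → V),
    Function.Injective g ∧ Set.range g = {v | P.toRootedTree.IsTop v} ∧
      P.toRootedTree.IsBranching ∧ Generates W Set.univ (extendZero g '' T) (extendZero g '' S)

theorem IsNPair.isRealizable [Subsingleton ι] [Nonempty ι] (h : IsNPair T S) :
    IsRealizable T S := by
  obtain ⟨i⟩ := ‹Nonempty ι›
  let P : ParentTree ι := ⟨i, id, 0, rfl, fun v hv => absurd (Subsingleton.elim v i) hv⟩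
  have htop (v : ι) : P.toRootedTree.IsTop v :=
    Set.eq_empty_iff_forall_notMem.2 fun u hu => (P.mem_offspring.1 hu).1 (Subsingleton.elim u i)
  let c : ℕ →+ (ι → ℕ) := Pi.constAddMonoidHom ι ℕ
  have hc (x : ι → ℕ) : c (x i) = x := funext fun j => congrArg x (Subsingleton.elim i j)
  have hsurj (x : ι → ℕ) : x ∈ Set.range c := ⟨x i, hc x⟩
  let W : Weight P.toRootedTree :=
    { T₀ := c ⁻¹' T
      S₀ := c ⁻¹' S
      initial := IsPairOf.preimage h (Function.LeftInverse.injective (g := fun x => x i)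
        fun _ => rfl) fun a b _ => ⟨hsurj a, hsurj b⟩
      δ := 0
      α := 1
      C := fun _ => {0}
      D := fun _ => {0}
      size := 1
      α_pos := fun v hv => absurd (Subsingleton.elim v i) hv
      interval := fun _ _ => isIntervalPair_one
      δ_root_of_left := fun hi => absurd (htop i) hi
      δ_root_of_right := fun hi => absurd (htop i) hi }
  have hbox (R : Set (ι → ℕ)) : box {i} (fun _ => c ⁻¹' R) = extendZero id '' R := by
    ext x
    simp [box, extendZero_id, hc, Subsingleton.elim _ i]
  refine ⟨ι, inferInstance, P, W, id, Function.injective_id, ?_, fun v hv => absurd (htop v) hv, ?_⟩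
  · simp [htop]
  · have huniv : (Set.univ : Set ι) = {i} := Set.eq_singleton_iff_unique_mem.2
      ⟨Set.mem_univ i, fun j _ => Subsingleton.elim j i⟩
    rw [← hbox, ← hbox, huniv]
    exact Generates.root (W := W)

section GraftIndex

open Classical in
/-- Indexing of the tops after grafting the nodes of `B` at `z`, where `g` indexes the old tops. -/
noncomputable def graftIndex {V : Type*} {B : Set ι} {z : ι} (g : ↥(insert z Bᶜ) → V) (i : ι) :
    V ⊕ B :=
  if hi : i ∈ B then .inr ⟨i, hi⟩ else .inl (g ⟨i, .inr hi⟩)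

variable {V : Type*} {B : Set ι} {z : ι} {g : ↥(insert z Bᶜ) → V}

theorem graftIndex_of_mem {i : ι} (hi : i ∈ B) : graftIndex g i = .inr ⟨i, hi⟩ := dif_pos hi

theorem graftIndex_of_notMem {i : ι} (hi : i ∉ B) : graftIndex g i = .inl (g ⟨i, .inr hi⟩) :=
  dif_neg hi

theorem graftIndex_injective (hg : Function.Injective g) : Function.Injective (graftIndex g) := by
  intro i j hij
  by_cases hi : i ∈ B <;> by_cases hj : j ∈ B <;>
    simp_all [graftIndex_of_mem, graftIndex_of_notMem, hg.eq_iff, Subtype.ext_iff]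

theorem graftIndex_image : graftIndex g '' B = Set.range Sum.inr := by
  ext w
  constructor
  · rintro ⟨i, hi, rfl⟩
    exact ⟨⟨i, hi⟩, (graftIndex_of_mem hi).symm⟩
  · rintro ⟨⟨i, hi⟩, rfl⟩
    exact ⟨i, hi, graftIndex_of_mem hi⟩

theorem range_graftIndex (hz : z ∈ B) (hg : Function.Injective g) :
    Set.range (graftIndex g) =
      Sum.inl '' (Set.range g \ {g ⟨z, .inl rfl⟩}) ∪ Set.range Sum.inr := by
  rw [← graftIndex_image (g := g), ← Set.image_univ, ← Set.compl_union_self B, Set.image_union]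
  congr 1
  ext w
  constructor
  · rintro ⟨i, hi, rfl⟩
    have hiz : i ≠ z := fun h => hi (h ▸ hz)
    exact ⟨g ⟨i, .inr hi⟩, ⟨⟨_, rfl⟩, fun h => hiz (congrArg Subtype.val (hg h))⟩,
      (graftIndex_of_notMem hi).symm⟩
  · rintro ⟨_, ⟨⟨⟨i, rfl | hi⟩, rfl⟩, hiz⟩, rfl⟩
    · exact absurd rfl hiz
    · exact ⟨i, hi, graftIndex_of_notMem hi⟩

theorem extend_graft_eq (hg : Function.Injective g) {C : ι → Set ℕ} {a N : ι → ℕ}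
    (C₀ : V → Set ℕ) (a₀ N₀ : V → ℕ) (ε : Fin 2) (R : Set (↥(insert z Bᶜ) → ℕ)) :
    extend (.inl (g ⟨z, .inl rfl⟩)) (Set.range .inr) (Sum.elim C₀ fun b : B => C b)
        (Sum.elim a₀ fun b : B => a b) (Sum.elim N₀ fun b : B => N b) ε
        (extendZero Sum.inl '' (extendZero g '' R)) =
      extendZero (graftIndex g) '' extend z B C a N ε (extendZero Subtype.val '' R) := by
  have heqOn {γ : Type _} (F₀ : V → γ) (F : ι → γ) :
      Set.EqOn (Sum.elim F₀ (fun b : B => F b) ∘ graftIndex g) F B := fun i hi => by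
    rw [Function.comp_apply, graftIndex_of_mem hi, Sum.elim_inr]
  have hinl : Function.Injective (Sum.inl : V → V ⊕ B) := Sum.inl_injective
  rw [Set.image_image]
  simp only [extendZero_extendZero hinl hg]
  rw [← extend_congr (heqOn a₀ a) (heqOn N₀ N) (heqOn C₀ C), ← graftIndex_image (g := g)]
  refine extend_image_extendZero (x₀ := ⟨z, .inl rfl⟩) (graftIndex_injective hg) (hinl.comp hg)
    Subtype.val_injective (fun x hx => ?_) (fun i hi => ?_) B _ _ _ ε R
  · have hxB : x.1 ∉ B := x.2.resolve_left fun h => hx (Subtype.ext h)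
    exact (graftIndex_of_notMem hxB).symm
  · by_cases hiB : i ∈ B
    · rw [graftIndex_of_mem hiB] at hi
      exact absurd hi Sum.inr_ne_inl
    · rw [graftIndex_of_notMem hiB] at hi
      exact congrArg Subtype.val (hg (hinl hi))

end GraftIndex

theorem IsRealizable.extend [Finite ι] {B : Set ι} {z : ι} (hB : B.Nontrivial) (hz : z ∈ B)
    {C D : ι → Set ℕ} {a N : ι → ℕ} {ε : Fin 2} (ha : ∀ i ∈ B, 0 < a i)
    (hC : ∀ i ∈ B, IsIntervalPair (N i) (C i) (D i)) {T S : Set (↥(insert z Bᶜ) → ℕ)}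
    (hT : T = {0} → ε = 1) (hS : S = {0} → ε = 0) (h : IsRealizable T S) :
    IsRealizable (extend z B C a N ε (extendZero Subtype.val '' T))
      (extend z B D a N (1 - ε) (extendZero Subtype.val '' S)) := by
  obtain ⟨V, _, P, W, g, hg, hrange, hbranching, hgen⟩ := h
  have := hB.coe_sort
  have hgz : P.toRootedTree.IsTop (g ⟨z, .inl rfl⟩) := hrange.le ⟨_, rfl⟩
  have isTop_root (hroot : P.root = g ⟨z, .inl rfl⟩) : P.toRootedTree.IsTop P.root :=
    hroot ▸ hgz
  have eq_zero {R : Set (↥(insert z Bᶜ) → ℕ)} {R₀ : Set ℕ} {r : V}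
      (hR : extendZero g '' R = box {r} fun _ => R₀) (hR₀ : R₀ = {0}) : R = {0} := by
    refine (extendZero_injective hg).image_injective ?_
    rw [hR, hR₀, Set.image_singleton, map_zero]
    ext y
    refine ⟨fun hy => funext fun v => ?_, ?_⟩
    · by_cases hv : v ∈ ({r} : Set V)
      exacts [hy.1 v hv, hy.2 v hv]
    · rintro rfl
      exact ⟨fun _ _ => rfl, fun _ _ => rfl⟩
  let W' : Weight (P.graft (g ⟨z, .inl rfl⟩) B).toRootedTree :=
    W.graft _ (fun b => C b) (fun b => D b) (fun b => a b) (fun b => N b) ε (fun b => ha b b.2)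
      (fun b => hC b b.2)
      (fun hroot => ((hgen.eq_of_isTop_root hroot).1.le (Set.mem_univ (g ⟨z, .inl rfl⟩))).symm)
      (fun hroot h₀ => hT (eq_zero (hgen.eq_of_isTop_root (isTop_root hroot)).2.1 h₀))
      (fun hroot h₀ => hS (eq_zero (hgen.eq_of_isTop_root (isTop_root hroot)).2.2 h₀))
  refine ⟨V ⊕ B, inferInstance, _, W', graftIndex g, graftIndex_injective hg, ?_,
    P.isBranching_graft hgz hbranching, ?_⟩
  · rw [range_graftIndex hz hg, P.setOf_isTop_graft hgz, hrange]
  · rw [← extend_graft_eq hg W.C W.α W.size, ← extend_graft_eq hg W.D W.α W.size]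
    exact hgen.graft hgz

theorem IsPrimitiveNPair.isRealizable [Finite ι] [Nonempty ι] (h : IsPrimitiveNPair T S) :
    IsRealizable T S := by
  induction hn : Nat.card ι using Nat.strong_induction_on generalizing ι with
  | _ n ih =>
  obtain hι | hι := subsingleton_or_nontrivial ι
  · exact h.1.isRealizable
  obtain ⟨B, z, C, D, a, N, ε, T', S', hB, hz, ha, hC, h', hT', hS', rfl, rfl⟩ := h.exists_extend
  let f : ↥(insert z Bᶜ) → ι := Subtype.val
  have hf : Function.Injective f := Subtype.val_injective
  have hrange : Set.range f = insert z Bᶜ := Subtype.range_coe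
  have himage {R : Set (ι → ℕ)} (hR : R ⊆ face (insert z Bᶜ)) :
      extendZero f '' (extendZero f ⁻¹' R) = R :=
    image_extendZero_preimage hf (by rwa [hrange])
  have hzero {R : Set (ι → ℕ)} (hR : R ⊆ face (insert z Bᶜ)) (hR₀ : extendZero f ⁻¹' R = {0}) :
      R = {0} := by
    rw [← himage hR, hR₀, Set.image_singleton, map_zero]
  have hcard : Nat.card ↥(insert z Bᶜ) < n := by
    have hins := Set.ncard_insert_of_notMem (s := Bᶜ) (Set.notMem_compl_iff.2 hz)
    have hcompl := Set.ncard_add_ncard_compl B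
    have := (Set.one_lt_ncard_iff_nontrivial).2 hB
    rw [Nat.card_coe_set_eq]
    omega
  have hreal := ih _ hcard (IsPrimitiveOn.preimage_extendZero hf (hrange.symm ▸ h')) rfl
  have := hreal.extend hB hz ha (fun i _ => hC i) (fun h₀ => hT' (hzero h'.pair.left_subset h₀))
    fun h₀ => hS' (hzero h'.pair.right_subset h₀)
  rwa [himage h'.pair.left_subset, himage h'.pair.right_subset] at this

end Realizable

end NPair

theorem mainTheorem2 (n : ℕ) (hn : 1 ≤ n) (T S : Set (Fin n → ℕ)) :
    NPair.IsPrimitiveNPair T S ↔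
      ∃ (V : Type) (_ : Finite V) (Γ : NPair.RootedTree V) (W : NPair.Weight Γ)
        (e : Fin n ≃ {v : V // Γ.IsTop v}),
        Γ.IsBranching ∧ NPair.IsGeneratedBy W e T S := by
  constructor
  · intro h
    have : Nonempty (Fin n) := ⟨⟨0, hn⟩⟩
    obtain ⟨V, hV, P, W, g, hg, hrange, hΓ, hgen⟩ := h.isRealizable
    let e : Fin n ≃ {v // P.toRootedTree.IsTop v} :=
      (Equiv.ofInjective g hg).trans (Equiv.setCongr hrange)
    have restrict_image (R : Set (Fin n → ℕ)) :
        R = (fun y i => y (e i)) '' (NPair.extendZero g '' R) := by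
      have hid (y : Fin n → ℕ) : (fun i => NPair.extendZero g y (e i)) = y :=
        funext fun i => NPair.extendZero_apply hg y i
      simp only [Set.image_image, hid, Set.image_id']
    exact ⟨V, hV, P.toRootedTree, W, e, hΓ, _, _, hgen, restrict_image T, restrict_image S⟩
  · rintro ⟨V, _, Γ, W, e, hΓ, T', S', hgen, rfl, rfl⟩
    let f : Fin n → V := fun i => e i
    have hf : Function.Injective f := Subtype.val_injective.comp e.injective
    have hrange : Γ.topsIn Set.univ = Set.range f := by
      rw [Γ.topsIn_univ]
      exact ((e.surjective.range_comp Subtype.val).trans Subtype.range_coe).symm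
    have h := hrange ▸ hgen.isPrimitiveOn hΓ
    have := h.preimage_extendZero hf
    rwa [NPair.preimage_extendZero hf h.pair.left_subset,
      NPair.preimage_extendZero hf h.pair.right_subset] at this
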